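/- Let $L$ be a first-order language and let $$\phi=\forall x\,\exists y\,\Big(\bigwedge_{1\le i\le m}u_i\perp_{w_i}v_i\;\wedge\;\theta\Big)$$ be an independence logic sentence in normal form: $x$ and $y$ are finite tuples of pairwise distinct variables, each $u_i,v_i,w_i$ is a finite (possibly empty) tuple of variables from $y$, and $\theta$ is a quantifier-free first-order $L$-formula in the variables $xy$. Let $p_0=0$ and $p_n=p_{n-1}+m(p_{n-1}+n+1)^2$ for $n\ge 1$. For $n\ge 0$ and $-n\le j\le p_n$ let $x_{n,j},y_{n,j}$ be tuples of new, pairwise distinct variables of the same lengths as $x,y$; write $\theta_{n,j}=\theta(x_{n,j}y_{n,j}/xy)$ and $e^i_{n,j}=e_i(x_{n,j}y_{n,j}/xy)$ for $e\in\{u,v,w\}$, and let $\pi^i_{n,j,k}$ be $\bot$ if $w_i$ is empty and $\neg\, w^i_{n,j}=w^i_{n,k}$ otherwise. Let $\Psi^0=\theta_{0,0}$ and, for $n\ge 1$, $$\Psi^n=\bigwedge_{-n\le j\le p_n}\theta_{n,j}\;\wedge\bigwedge_{-n+1\le j\le p_{n-1}}x_{n,j}y_{n,j}=x_{n-1,j}y_{n-1,j}\;\wedge\bigwedge_{\substack{1\le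 i\le m\\ -n\le j,k\le p_{n-1}}}\Big(\pi^i_{n,j,k}\vee\bigvee_{p_{n-1}<l\le p_n}u^i_{n,j}v^i_{n,k}w^i_{n,j}=u^i_{n,l}v^i_{n,l}w^i_{n,l}\Big).$$ The $n$-th approximation of $\phi$ is the first-order sentence $$\Phi^n=\forall x_{0,0}\exists y_{0,0}\big(\Psi^0\wedge\forall x_{1,-1}\exists y_{1,-1}\exists x_{1,0}\exists y_{1,0}\cdots\exists x_{1,p_1}\exists y_{1,p_1}\big(\Psi^1\wedge\cdots\forall x_{n,-n}\exists y_{n,-n}\exists x_{n,-n+1}\exists y_{n,-n+1}\cdots\exists x_{n,p_n}\exists y_{n,p_n}(\Psi^n)\cdots\big)\big),$$ and $\Phi$ is the infinitary game expression obtained by continuing this prefix through all levels $n\in\mathbb N$. Thus $M\models\Phi$ means that player II has a winning strategy in the following game of length $\omega$: in round $n$ player I chooses values in $M$ for $x_{n,-n}$, after which player II chooses values in $M$ for all the other variables $y_{n,-n},x_{n,-n+1},y_{n,-n+1},\dots,x_{n,p_n},y_{n,p_n}$ of level $n$; player II wins if the resulting assignment satisfies $\Psi^n$ for every $n$. An $L$-structure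 $M$ is recursively saturated if (for some numbering of the symbols of $L$ by natural numbers, by which $L$-formulas receive Gödel numbers) it satisfies $$\forall\bar x\Big(\Big(\bigwedge_{n}\exists z\bigwedge_{k\le n}\psi_k(\bar x,z)\Big)\rightarrow\exists z\bigwedge_n\psi_n(\bar x,z)\Big)$$ for every finite tuple of variables $\bar x$, every single variable $z$ and all first-order $L$-formulas $\psi_n(\bar x,z)$ $(n\in\mathbb N)$ such that the set $\{\psi_n(\bar x,z)\mid n\in\mathbb N\}$ is recursive. If $M$ is an $L$-structure that is recursively saturated or finite, then $$M\models\Phi\quad\text{if and only if}\quad M\models\Phi^n\text{ for all }n\in\mathbb N.$$ -/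

import Mathlib

universe a b c

namespace IndependenceLogic

/-- The data of an independence logic sentence in normal form
`∀ x ∃ y (⋀ i, u i ⊥_{w i} v i ∧ θ)`: `x` and `y` are tuples of `lenX` and `lenY` pairwise distinct
variables, the `u i`, `v i`, `w i` (for `numAtoms` many `i`) are finite, possibly empty, tuples of
variables from `y`, and `θ` is a quantifier-free first-order formula in the variables `xy`. -/
structure NormalForm (L : FirstOrder.Language.{a, b}) where
  lenX : ℕ
  lenY : ℕ
  numAtoms : ℕ
  u : Fin numAtoms → List (Fin lenY)
  v : Fin numAtoms → List (Fin lenY)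
  w : Fin numAtoms → List (Fin lenY)
  θ : L.Formula (Fin lenX ⊕ Fin lenY)
  θ_isQF : θ.IsQF

/-- Equality of two tuples of variables of the same length, as a first-order formula. -/
def eqTuple {L : FirstOrder.Language.{a, b}} {α : Type} (s t : List α) : L.Formula α :=
  (List.zipWith (fun p q => (FirstOrder.Language.Term.var p).equal (FirstOrder.Language.Term.var q)) s t).foldr (· ⊓ ·) ⊤

namespace NormalForm

variable {L : FirstOrder.Language.{a, b}} (φ : NormalForm L)

/-- `p 0 = 0` and `p n = p (n - 1) + m * (p (n - 1) + n + 1) ^ 2` for `n ≥ 1`. -/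
def p : ℕ → ℕ
  | 0 => 0
  | n + 1 => p n + φ.numAtoms * (p n + (n + 1) + 1) ^ 2

/-- The indices `-n ≤ i ≤ p n` of the tuples `x_{n,i} y_{n,i}` of level `n`. -/
abbrev Idx (n : ℕ) : Type :=
  {i : ℤ // i ∈ Finset.Icc (-(n : ℤ)) (φ.p n)}

/-- The variables of level `n`: `(i, inl c)` is the `c`-th variable of `x_{n,i}` and
`(i, inr c)` is the `c`-th variable of `y_{n,i}`. -/
abbrev LevelVar (n : ℕ) : Type :=
  φ.Idx n × (Fin φ.lenX ⊕ Fin φ.lenY)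

/-- The variables of the level before level `n`; there are none before level `0`. -/
abbrev PrevVar : ℕ → Type
  | 0 => Empty
  | n + 1 => φ.LevelVar n

/-- The variables of level `n` which are quantified universally, namely those of `x_{n,-n}`. -/
def IsUniversal (n : ℕ) (z : φ.LevelVar n) : Prop :=
  z.1.1 = -(n : ℤ) ∧ z.2.isLeft = true

instance (n : ℕ) : DecidablePred (φ.IsUniversal n) :=
  fun z => inferInstanceAs (Decidable (z.1.1 = -(n : ℤ) ∧ z.2.isLeft = true))

abbrev UnivVar (n : ℕ) : Type := {z : φ.LevelVar n // φ.IsUniversal n z}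

/-- The variables of level `n` which are quantified existentially: all those of
`y_{n,-n}, x_{n,-n+1}, y_{n,-n+1}, …, x_{n,p n}, y_{n,p n}`. -/
abbrev ExVar (n : ℕ) : Type := {z : φ.LevelVar n // ¬ φ.IsUniversal n z}

/-- An index of level `n` is also an index of level `n + 1`. -/
def liftIdx {n : ℕ} (i : φ.Idx n) : φ.Idx (n + 1) :=
  ⟨i.1, by
    have h := Finset.mem_Icc.1 i.2
    have h' : φ.p n ≤ φ.p (n + 1) := Nat.le_add_right _ _
    refine Finset.mem_Icc.2 ⟨?_, ?_⟩
    · push_cast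
      linarith [h.1]
    · exact h.2.trans (by exact_mod_cast h')⟩

/-- For a tuple `e` of variables from `y`, the tuple `e(x_{n,i} y_{n,i} / x y)`. -/
def tup {n : ℕ} (e : List (Fin φ.lenY)) (i : φ.Idx n) : List (φ.PrevVar n ⊕ φ.LevelVar n) :=
  e.map fun c => Sum.inr (i, Sum.inr c)

/-- `θ_{n,i} = θ(x_{n,i} y_{n,i} / x y)`. -/
def thetaAt {n : ℕ} (i : φ.Idx n) : L.Formula (φ.PrevVar n ⊕ φ.LevelVar n) :=
  φ.θ.relabel fun z => Sum.inr (i, z)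

/-- `π^i_{n,j,k}`: it is `⊥` if `w i` is empty, and `¬ w^i_{n,j} = w^i_{n,k}` otherwise. -/
def piAt {n : ℕ} (i : Fin φ.numAtoms) (j k : φ.Idx n) :
    L.Formula (φ.PrevVar n ⊕ φ.LevelVar n) :=
  if φ.w i = [] then ⊥ else (eqTuple (φ.tup (φ.w i) j) (φ.tup (φ.w i) k)).not

/-- `Ψ^n`, a quantifier-free formula in the variables of the levels `n` and (if `n ≥ 1`) `n - 1`. -/
noncomputable def Psi : ∀ n : ℕ, L.Formula (φ.PrevVar n ⊕ φ.LevelVar n)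
  | 0 => φ.thetaAt ⟨0, by simp [p]⟩
  | n + 1 =>
    -- `θ_{n+1,i}` for `-(n+1) ≤ i ≤ p (n+1)`
    (FirstOrder.Language.Formula.iInf fun i : φ.Idx (n + 1) => φ.thetaAt i) ⊓
    -- `x_{n+1,i} y_{n+1,i} = x_{n,i} y_{n,i}` for `-n ≤ i ≤ p n`
    ((FirstOrder.Language.Formula.iInf fun z : φ.LevelVar n =>
      (FirstOrder.Language.Term.var (Sum.inr (φ.liftIdx z.1, z.2))).equal (FirstOrder.Language.Term.var (Sum.inl z))) ⊓
    -- the part on the independence atoms, with `-(n+1) ≤ j, k ≤ p n` and `p n < l ≤ p (n+1)`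
    (FirstOrder.Language.Formula.iInf fun i : Fin φ.numAtoms =>
      FirstOrder.Language.Formula.iInf fun j : {j : φ.Idx (n + 1) // j.1 ≤ φ.p n} =>
        FirstOrder.Language.Formula.iInf fun k : {k : φ.Idx (n + 1) // k.1 ≤ φ.p n} =>
          φ.piAt i j.1 k.1 ⊔
          FirstOrder.Language.Formula.iSup fun l : {l : φ.Idx (n + 1) // (φ.p n : ℤ) < l.1} =>
            eqTuple
              (φ.tup (φ.u i) j.1 ++ φ.tup (φ.v i) k.1 ++ φ.tup (φ.w i) j.1)
              (φ.tup (φ.u i) l.1 ++ φ.tup (φ.v i) l.1 ++ φ.tup (φ.w i) l.1)))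

/-- The quantifier block of level `n`:
`∀ x_{n,-n} ∃ y_{n,-n} ∃ x_{n,-n+1} ∃ y_{n,-n+1} … ∃ x_{n,p n} ∃ y_{n,p n} χ`. -/
noncomputable def quantify (n : ℕ) (χ : L.Formula (φ.PrevVar n ⊕ φ.LevelVar n)) :
    L.Formula (φ.PrevVar n) :=
  FirstOrder.Language.Formula.iAlls (φ.UnivVar n) <| FirstOrder.Language.Formula.iExs (φ.ExVar n) <|
    χ.relabel <| Sum.elim (fun z => Sum.inl (Sum.inl z)) fun z =>
      if h : φ.IsUniversal n z then Sum.inl (Sum.inr ⟨z, h⟩) else Sum.inr ⟨z, h⟩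

/-- `∀ x_{n,-n} ∃ … (Ψ^n ∧ ∀ x_{n+1,-(n+1)} ∃ … (Ψ^{n+1} ∧ … ∀ x_{n+d,-(n+d)} ∃ … (Ψ^{n+d}) … ))`. -/
noncomputable def approxFrom : ℕ → ∀ n : ℕ, L.Formula (φ.PrevVar n)
  | 0, n => φ.quantify n (φ.Psi n)
  | d + 1, n => φ.quantify n (φ.Psi n ⊓ (approxFrom d (n + 1)).relabel Sum.inr)

/-- The `n`-th approximation `Φ^n`, a first-order sentence. -/
noncomputable def approx (n : ℕ) : L.Sentence := φ.approxFrom n 0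

section Game

variable (M : Type c)

/-- A strategy of player II: her move in round `n` as a function of the moves of player I in the
rounds `0, …, n`. In round `n` player I chooses values for `x_{n,-n}`, then player II chooses values
for all the other variables of level `n`. -/
abbrev Strategy : Type c :=
  ∀ n : ℕ, (∀ k : ℕ, k ≤ n → φ.UnivVar k → M) → φ.ExVar n → M

variable {M}

/-- The values of the variables of level `n` when player I plays `f` and player II follows `σ`. -/
def play (σ : φ.Strategy M) (f : ∀ k : ℕ, φ.UnivVar k → M) (n : ℕ) (z : φ.LevelVar n) : M :=
  if h : φ.IsUniversal n z then f n ⟨z, h⟩ else σ n (fun k _ => f k) ⟨z, h⟩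

/-- The same for the level before level `n`. -/
def playPrev (σ : φ.Strategy M) (f : ∀ k : ℕ, φ.UnivVar k → M) : ∀ n : ℕ, φ.PrevVar n → M
  | 0 => Empty.elim
  | n + 1 => φ.play σ f n

variable (M)

/-- Truth of the game expression `Φ` in `M`: player II has a strategy such that, however player I
plays, the resulting assignment satisfies `Ψ^n` for all `n`. -/
def GameHolds [L.Structure M] : Prop :=
  ∃ σ : φ.Strategy M, ∀ f : (∀ k : ℕ, φ.UnivVar k → M), ∀ n : ℕ,
    (φ.Psi n).Realize (Sum.elim (φ.playPrev σ f n) (φ.play σ f n))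

end Game

end NormalForm

section RecursiveSaturation

variable (L : FirstOrder.Language.{a, b})
  [Encodable (Σ k, L.Functions k)] [Encodable (Σ k, L.Relations k)]

/-- The Gödel number of a formula in the variables `0, …, k - 1`, obtained from a numbering of the
nonlogical symbols by writing the formula as a string of symbols. -/
def goedelNumber {k : ℕ} (ψ : L.Formula (Fin k)) : ℕ :=
  Encodable.encode (FirstOrder.Language.BoundedFormula.listEncode ψ)

theorem goedelNumber_injective (k : ℕ) :
    Function.Injective (goedelNumber L : L.Formula (Fin k) → ℕ) := by
  intro ψ χ h
  have h1 := Encodable.encode_injective h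
  have h2 : (⟨0, ψ⟩ : Σ n, L.BoundedFormula (Fin k) n) = ⟨0, χ⟩ :=
    FirstOrder.Language.BoundedFormula.listEncode_sigma_injective h1
  simpa using h2

/-- A set of formulas is recursive if the set of its Gödel numbers is decidable. -/
def IsRecursiveSet {k : ℕ} (S : Set (L.Formula (Fin k))) : Prop :=
  ComputablePred fun e : ℕ => e ∈ goedelNumber L '' S

/-- `M` is recursively saturated: it satisfies
`∀ x̄ ((⋀ n, ∃ y ⋀ m ≤ n, ψ m (x̄, y)) → ∃ y ⋀ n, ψ n (x̄, y))`
whenever `{ψ n (x̄, y) | n ∈ ℕ}` is recursive. -/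
def IsRecursivelySaturated (M : Type c) [L.Structure M] : Prop :=
  ∀ (k : ℕ) (ψ : ℕ → L.Formula (Fin (k + 1))), IsRecursiveSet L (Set.range ψ) →
    ∀ x : Fin k → M,
      (∀ n, ∃ y : M, ∀ m ≤ n, (ψ m).Realize (Fin.snoc x y : Fin (k + 1) → M)) →
        ∃ y : M, ∀ n, (ψ n).Realize (Fin.snoc x y : Fin (k + 1) → M)

end RecursiveSaturation

end IndependenceLogic

/-! A winning strategy for player II, cut off after finitely many rounds, witnesses the quantifiers
of every approximation; this is `GameHolds.realize_approx`.

Conversely, player II preserves the invariant that the last completed level satisfies every finite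
continuation `approxFrom d n`. By `gameHolds_of_forall_exists` such an invariant yields a strategy,
so only one round has to be played. Once player I has moved, the invariant provides for each `d` an
answer that satisfies `Psi n` and the continuation `approxFrom d (n + 1)`. A single answer for all
`d` is needed (`exists_forall_realize_approxFrom`). The requirements grow stronger with `d`. If `M`
is finite there are only finitely many answers, and one of them works for all `d`. If `M` is
recursively saturated, the requirements form a finitely satisfiable type in finitely many variables
over finitely many parameters, and this type is realized once it is known to be recursive.

Most of the work is recursiveness. No codes of the formulas `approxFrom` themselves are computed.
They are replaced by predicates `ApproxHolds` of assignments `ℕ → M`, equivalent by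
`realize_approxFrom_iff_approxHolds`, and `isPrimrecFamily_approxHolds` writes down primitive
recursive symbol strings of formulas defining these predicates. Variables of consecutive levels
which `Psi` forces to be equal share one number, so a position in the game is an initial segment of
one growing sequence of variables. Finally `IsPrimrecFamily.exists_isRecursiveSet` turns a primitive
recursive family into a recursive set, and `IsRecursivelySaturated.exists_forall` extends saturation
to several variables. -/

namespace IndependenceLogic

open FirstOrder.Language Encodable

/-! ### Codes of terms under a renaming of variables. -/

section Terms

variable {L : FirstOrder.Language.{a, b}} {M : Type c} [L.Structure M]
  [Encodable (Σ k, L.Functions k)]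

/-- The variable with number `v`, if there are `K` free and `N` bound variables. -/
def varOf (K N v : ℕ) (h : v < K + N) : Fin K ⊕ Fin N :=
  if hv : v < K then .inl ⟨v, hv⟩ else .inr ⟨v - K, by omega⟩

theorem encode_varOf {K N v : ℕ} (h : v < K + N) :
    encode (varOf K N v h) = if v < K then 2 * v else 2 * (v - K) + 1 := by
  unfold varOf
  split <;> rfl

theorem elim_varOf {K N v : ℕ} (h : v < K + N) (f : ℕ → M) :
    Sum.elim (fun i : Fin K => f i) (fun i : Fin N => f (K + i)) (varOf K N v h) = f v := by
  unfold varOf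
  split
  · rfl
  · simp only [Sum.elim_inr]
    congr 1
    omega

/-- Only the variables of the fixed term `t` move with the parameter `s`, so the code is assembled
by finitely many primitive recursive operations, following the structure of `t`. The set `D` marks
the parameters for which the new variable numbers are in range. -/
theorem exists_term_code {σ : Type*} [Primcodable σ] {K : ℕ} {D : σ → Prop} {N : σ → ℕ}
    {β : Type*} (hN : Primrec N) (ρ : σ → β → ℕ)
    (hρ : ∀ b, Primrec fun s => ρ s b) (hD : ∀ s, D s → ∀ b, ρ s b < K + N s) (t : L.Term β) :
    ∃ l : σ → ℕ, Primrec l ∧ ∀ s, D s → ∃ t' : L.Term (Fin K ⊕ Fin (N s)),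
      encode (⟨N s, t'⟩ : Σ k, L.Term (Fin K ⊕ Fin k)) = l s ∧
      ∀ f : ℕ → M, t'.realize (Sum.elim (fun i : Fin K => f i) fun i : Fin (N s) => f (K + i)) =
        t.realize fun b => f (ρ s b) := by
  have key : ∃ l : σ → List ℕ, Primrec l ∧ ∀ s (hs : D s),
      (t.relabel fun b => varOf K (N s) (ρ s b) (hD s hs b)).listEncode.map encode = l s := by
    induction t with
    | var b =>
      refine ⟨fun s => [2 * if ρ s b < K then 2 * ρ s b else 2 * (ρ s b - K) + 1],
        Primrec.list_cons.comp (Primrec.nat_mul.comp (.const 2) (Primrec.ite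
          (Primrec.nat_lt.comp (hρ b) (.const K)) (Primrec.nat_mul.comp (.const 2) (hρ b))
          (Primrec.succ.comp (Primrec.nat_mul.comp (.const 2)
            (Primrec.nat_sub.comp (hρ b) (.const K)))))) (.const []), fun s hs => ?_⟩
      simp [Term.relabel, Term.listEncode, encode_varOf]
    | @func n F ts ih =>
      choose l hl h using ih
      have aux : ∀ I : List (Fin n), Primrec fun s => I.flatMap fun i => l i s := by
        intro I
        induction I with
        | nil => exact .const []
        | cons i I ih => exact Primrec.list_append.comp (hl i) ih
      refine ⟨fun s => (2 * encode (⟨n, F⟩ : Σ k, L.Functions k) + 1) ::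
          (List.finRange n).flatMap fun i => l i s,
        Primrec.list_cons.comp (.const _) (aux _), fun s hs => ?_⟩
      simp [Term.relabel, Term.listEncode, List.map_flatMap, h _ s hs]
  obtain ⟨l, hl, h⟩ := key
  refine ⟨fun s => Nat.pair (N s) (encode (l s)), Primrec₂.natPair.comp hN (Primrec.encode.comp hl),
    fun s hs => ⟨t.relabel fun b => varOf K (N s) (ρ s b) (hD s hs b), ?_, fun f => ?_⟩⟩
  · beta_reduce
    rw [← h s hs, encode_sigma_val]
    congr 1
    generalize t.relabel _ = t'
    change encode t'.listEncode = _
    generalize t'.listEncode = I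
    induction I with
    | nil => rfl
    | cons x I ih => simp [ih]
  · rw [Term.realize_relabel]
    congr 1
    funext b
    exact elim_varOf _ _

end Terms

/-! ### Codes of formulas and primitive recursive families of definable predicates. -/

section Coding

variable (L : FirstOrder.Language.{a, b}) (M : Type c) [L.Structure M]
  [Encodable (Σ k, L.Functions k)] [Encodable (Σ k, L.Relations k)]

/-- `l` lists the codes of the symbols of a formula in the free variables `0, …, K - 1` and the
bound variables `K, …, K + N - 1` which defines `P` in `M`. -/
def IsCode (K N : ℕ) (l : List ℕ) (P : (ℕ → M) → Prop) : Prop :=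
  ∃ ψ : L.BoundedFormula (Fin K) N, ψ.listEncode.map encode = l ∧
    ∀ f : ℕ → M, ψ.Realize (fun i => f i) (fun i => f (K + i)) ↔ P f

variable {L M}

/-- The code of the symbol `⊥` with `N` bound variables. -/
def falsumCode (N : ℕ) : ℕ := 2 * (2 * (N + 2) + 1) + 1

theorem IsCode.congr {K N : ℕ} {l : List ℕ} {P Q : (ℕ → M) → Prop} (h : IsCode L M K N l P)
    (hPQ : ∀ f, P f ↔ Q f) : IsCode L M K N l Q := by
  obtain ⟨ψ, h1, h2⟩ := h
  exact ⟨ψ, h1, fun f => (h2 f).trans (hPQ f)⟩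

theorem IsCode.falsum (K N : ℕ) : IsCode L M K N [falsumCode N] fun _ => False :=
  ⟨⊥, by simp [BoundedFormula.listEncode, falsumCode], fun f => by simp⟩

theorem IsCode.imp {K N : ℕ} {l l' : List ℕ} {P Q : (ℕ → M) → Prop} (h : IsCode L M K N l P)
    (h' : IsCode L M K N l' Q) : IsCode L M K N (3 :: (l ++ l')) fun f => P f → Q f := by
  obtain ⟨ψ, h1, h2⟩ := h
  obtain ⟨ψ', h1', h2'⟩ := h'
  refine ⟨ψ.imp ψ', by simp [BoundedFormula.listEncode, h1, h1'], fun f => ?_⟩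
  simp [h2, h2']

theorem IsCode.not {K N : ℕ} {l : List ℕ} {P : (ℕ → M) → Prop} (h : IsCode L M K N l P) :
    IsCode L M K N (3 :: (l ++ [falsumCode N])) fun f => ¬ P f :=
  h.imp (.falsum K N)

/-- A formula with `N` bound variables does not depend on the values of other variables. -/
theorem IsCode.congr_val {K N : ℕ} {l : List ℕ} {P : (ℕ → M) → Prop} (h : IsCode L M K N l P)
    {f g : ℕ → M} (hfg : ∀ v < K + N, f v = g v) : P f ↔ P g := by
  obtain ⟨ψ, -, h2⟩ := h
  have e1 : (fun i : Fin K => f i) = fun i : Fin K => g i := funext fun i => hfg _ (by omega)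
  have e2 : (fun i : Fin N => f (K + i)) = fun i : Fin N => g (K + i) := funext fun i => hfg _ (by omega)
  rw [← h2, ← h2, e1, e2]

theorem IsCode.all {K N : ℕ} {l : List ℕ} {P : (ℕ → M) → Prop} (h : IsCode L M K (N + 1) l P) :
    IsCode L M K N (7 :: l) fun f => ∀ x, P (Function.update f (K + N) x) := by
  obtain ⟨ψ, h1, h2⟩ := h
  refine ⟨ψ.all, by simp [BoundedFormula.listEncode, h1], fun f => ?_⟩
  rw [BoundedFormula.realize_all]
  refine forall_congr' fun x => ?_
  rw [← h2]
  have e1 : (fun i : Fin K => Function.update f (K + N) x i) = fun i : Fin K => f i :=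
    funext fun i => Function.update_of_ne (by omega) _ _
  have e2 : (fun i : Fin (N + 1) => Function.update f (K + N) x (K + i)) =
      Fin.snoc (fun i : Fin N => f (K + i)) x := by
    funext i
    refine Fin.lastCases ?_ (fun j => ?_) i
    · simp
    · rw [Fin.snoc_castSucc]
      exact Function.update_of_ne (by simp; omega) _ _
  rw [e1, e2]

/-- A block of `r` quantifiers is expressed by a single quantifier over assignments. Nothing bounds
the change of `g` from above, which is harmless because `P` depends only on the variables below `K +
N + r`. -/
theorem IsCode.alls {K : ℕ} (r : ℕ) : ∀ {N : ℕ} {l : List ℕ} {P : (ℕ → M) → Prop},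
    IsCode L M K (N + r) l P → IsCode L M K N (List.replicate r 7 ++ l) fun f =>
      ∀ g, (∀ v < K + N, g v = f v) → P g := by
  induction r with
  | zero =>
    intro N l P h
    refine IsCode.congr (P := P) (by simpa using h) fun f => ⟨fun hf g hg => ?_, fun hf => hf f
      fun _ _ => rfl⟩
    exact (h.congr_val hg).2 hf
  | succ r ih =>
    intro N l P h
    have h' : IsCode L M K (N + 1 + r) l P := by
      rwa [show N + 1 + r = N + (r + 1) by omega]
    refine (ih h').all.congr fun f => ⟨fun hf g hg => ?_, fun hf x g hg => hf g fun v hv => ?_⟩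
    · refine hf (g (K + N)) g fun v hv => ?_
      obtain rfl | hne := eq_or_ne v (K + N)
      · simp
      · rw [Function.update_of_ne hne]
        exact hg v (by omega)
    · rw [hg v (by omega), Function.update_of_ne (by omega)]

/-- A long conjunction is kept as a chain of implications nested to the right: in prefix notation
its code is a plain concatenation, hence a `flatMap`, with no closing symbols to match. -/
theorem IsCode.forall_imp {K N : ℕ} {ι : Type*} {l : ι → List ℕ}
    {l' : List ℕ} {P : ι → (ℕ → M) → Prop} {Q : (ℕ → M) → Prop} (hQ : IsCode L M K N l' Q)
    (t : List ι) (hP : ∀ i ∈ t, IsCode L M K N (l i) (P i)) :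
    IsCode L M K N (t.flatMap (fun i => 3 :: l i) ++ l') fun f => (∀ i ∈ t, P i f) → Q f := by
  induction t with
  | nil => exact IsCode.congr (by simpa using hQ) fun f => by simp
  | cons i t ih =>
    have h := (hP i (by simp)).imp (ih fun j hj => hP j (by simp [hj]))
    have e : (i :: t).flatMap (fun i => 3 :: l i) ++ l' =
        3 :: (l i ++ (t.flatMap (fun i => 3 :: l i) ++ l')) := by simp
    rw [e]
    exact h.congr fun f => by simp

variable (L M) in
/-- Over the parameters in `D`, the predicates `P s` are defined by formulas which are primitive
recursive in `s`, with `K` free and `N s` bound variables. -/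
def IsPrimrecFamily {σ : Type*} [Primcodable σ] (K : ℕ) (D : σ → Prop) (N : σ → ℕ)
    (P : σ → (ℕ → M) → Prop) : Prop :=
  ∃ l : σ → List ℕ, Primrec l ∧ ∀ s, D s → IsCode L M K (N s) (l s) (P s)

namespace IsPrimrecFamily

variable {σ τ : Type*} [Primcodable σ] [Primcodable τ] {K : ℕ} {D D' : σ → Prop} {N : σ → ℕ}
  {P Q : σ → (ℕ → M) → Prop}

theorem congr (h : IsPrimrecFamily L M K D N P) (hPQ : ∀ s, D s → ∀ f, P s f ↔ Q s f) :
    IsPrimrecFamily L M K D N Q := by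
  obtain ⟨l, hl, h⟩ := h
  exact ⟨l, hl, fun s hs => (h s hs).congr (hPQ s hs)⟩

theorem comp (h : IsPrimrecFamily L M K D N P) {g : τ → σ} (hg : Primrec g) {D' : τ → Prop}
    (hD : ∀ t, D' t → D (g t)) :
    IsPrimrecFamily L M K D' (fun t => N (g t)) fun t => P (g t) := by
  obtain ⟨l, hl, h⟩ := h
  exact ⟨fun t => l (g t), hl.comp hg, fun t ht => h _ (hD t ht)⟩

theorem primrec_falsumCode : Primrec falsumCode :=
  Primrec.succ.comp (Primrec.nat_mul.comp (.const 2) (Primrec.succ.comp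
    (Primrec.nat_mul.comp (.const 2) (Primrec.nat_add.comp .id (.const 2)))))

theorem primrec_falsumCode_singleton (hN : Primrec N) :
    Primrec fun s => [falsumCode (N s)] :=
  Primrec.list_cons.comp (primrec_falsumCode.comp hN) (.const [])

protected theorem falsum (hN : Primrec N) : IsPrimrecFamily L M K D N fun _ _ => False :=
  ⟨_, primrec_falsumCode_singleton hN, fun s _ => .falsum K (N s)⟩

protected theorem imp (hP : IsPrimrecFamily L M K D N P) (hQ : IsPrimrecFamily L M K D N Q) :
    IsPrimrecFamily L M K D N fun s f => P s f → Q s f := by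
  obtain ⟨l, hl, h⟩ := hP
  obtain ⟨l', hl', h'⟩ := hQ
  exact ⟨_, Primrec.list_cons.comp (.const 3) (Primrec.list_append.comp hl hl'),
    fun s hs => (h s hs).imp (h' s hs)⟩

protected theorem not (hN : Primrec N) (hP : IsPrimrecFamily L M K D N P) :
    IsPrimrecFamily L M K D N fun s f => ¬ P s f :=
  hP.imp (.falsum hN)

protected theorem const (hN : Primrec N) (p : Prop) : IsPrimrecFamily L M K D N fun _ _ => p := by
  by_cases hp : p
  · exact (IsPrimrecFamily.not hN (.falsum hN)).congr fun s _ f => by simp [hp]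
  · exact (IsPrimrecFamily.falsum hN).congr fun s _ f => by simp [hp]

protected theorem and (hN : Primrec N) (hP : IsPrimrecFamily L M K D N P)
    (hQ : IsPrimrecFamily L M K D N Q) : IsPrimrecFamily L M K D N fun s f => P s f ∧ Q s f :=
  (IsPrimrecFamily.not hN (hP.imp (hQ.not hN))).congr fun s _ f => by tauto

protected theorem or (hN : Primrec N) (hP : IsPrimrecFamily L M K D N P)
    (hQ : IsPrimrecFamily L M K D N Q) : IsPrimrecFamily L M K D N fun s f => P s f ∨ Q s f :=
  ((hP.not hN).imp hQ).congr fun s _ f => by tauto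

theorem forall_mem_list {ι : Type*} (hN : Primrec N) {P : ι → σ → (ℕ → M) → Prop} (t : List ι)
    (hP : ∀ i ∈ t, IsPrimrecFamily L M K D N (P i)) :
    IsPrimrecFamily L M K D N fun s f => ∀ i ∈ t, P i s f := by
  induction t with
  | nil => exact (IsPrimrecFamily.const hN True).congr fun s _ f => by simp
  | cons i t ih =>
    exact ((hP i (by simp)).and hN (ih fun j hj => hP j (by simp [hj]))).congr
      fun s _ f => by simp

theorem forall_fin {m : ℕ} (hN : Primrec N) {P : Fin m → σ → (ℕ → M) → Prop}
    (hP : ∀ i, IsPrimrecFamily L M K D N (P i)) :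
    IsPrimrecFamily L M K D N fun s f => ∀ i, P i s f :=
  (forall_mem_list hN (List.finRange m) fun i _ => hP i).congr fun s _ f => by simp

/-- The number of premises varies with the parameter, so iterating `IsPrimrecFamily.imp` would not
do. With a false conclusion this gives both bounded quantifiers. -/
theorem forall_lt_imp {B : σ → ℕ} (hB : Primrec B) {P : σ × ℕ → (ℕ → M) → Prop}
    (hP : IsPrimrecFamily L M K (fun s : σ × ℕ => D s.1 ∧ s.2 < B s.1) (fun s => N s.1) P)
    (hQ : IsPrimrecFamily L M K D N Q) :
    IsPrimrecFamily L M K D N fun s f => (∀ i < B s, P (s, i) f) → Q s f := by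
  obtain ⟨l, hl, h⟩ := hP
  obtain ⟨l', hl', h'⟩ := hQ
  refine ⟨fun s => (List.range (B s)).flatMap (fun i => 3 :: l (s, i)) ++ l' s,
    Primrec.list_append.comp (Primrec.list_flatMap (Primrec.list_range.comp hB) ?_) hl',
    fun s hs => ((h' s hs).forall_imp (List.range (B s)) (P := fun i => P (s, i))
      fun i hi => h (s, i) ⟨hs, List.mem_range.1 hi⟩).congr fun f => by simp⟩
  exact (Primrec.list_cons.comp (.const 3) hl).to₂

theorem forall_lt (hN : Primrec N) {B : σ → ℕ} (hB : Primrec B) {P : σ × ℕ → (ℕ → M) → Prop}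
    (hP : IsPrimrecFamily L M K (fun s : σ × ℕ => D s.1 ∧ s.2 < B s.1) (fun s => N s.1) P) :
    IsPrimrecFamily L M K D N fun s f => ∀ i < B s, P (s, i) f :=
  ((forall_lt_imp hB hP (.falsum hN)).not hN).congr fun _ _ _ => not_not

theorem exists_lt (hN : Primrec N) {B : σ → ℕ} (hB : Primrec B) {P : σ × ℕ → (ℕ → M) → Prop}
    (hP : IsPrimrecFamily L M K (fun s : σ × ℕ => D s.1 ∧ s.2 < B s.1) (fun s => N s.1) P) :
    IsPrimrecFamily L M K D N fun s f => ∃ i < B s, P (s, i) f :=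
  (forall_lt_imp hB (hP.not (hN.comp .fst)) (.falsum hN)).congr fun s _ f => by simp

theorem primrec_replicate (x : ℕ) : Primrec fun r => List.replicate r x :=
  (Primrec.list_map Primrec.list_range (g := fun _ _ => x) (Primrec.const x).to₂).of_eq
    fun r => by simp

theorem alls {r : σ → ℕ} (hr : Primrec r)
    (hP : IsPrimrecFamily L M K D (fun s => N s + r s) P) :
    IsPrimrecFamily L M K D N fun s f => ∀ g, (∀ v < K + N s, g v = f v) → P s g := by
  obtain ⟨l, hl, h⟩ := hP
  exact ⟨_, Primrec.list_append.comp ((primrec_replicate 7).comp hr) hl,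
    fun s hs => (h s hs).alls (r s)⟩

theorem exs {r : σ → ℕ} (hN : Primrec N) (hr : Primrec r)
    (hP : IsPrimrecFamily L M K D (fun s => N s + r s) P) :
    IsPrimrecFamily L M K D N fun s f => ∃ g, (∀ v < K + N s, g v = f v) ∧ P s g :=
  (IsPrimrecFamily.not hN (alls hr (hP.not (Primrec.nat_add.comp hN hr)))).congr
    fun s _ f => by simp

theorem realize_qf {β : Type*} (hN : Primrec N) (ρ : σ → β → ℕ)
    (hρ : ∀ b, Primrec fun s => ρ s b) (hD : ∀ s, D s → ∀ b, ρ s b < K + N s)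
    {θ : L.Formula β} (hθ : θ.IsQF) :
    IsPrimrecFamily L M K D N fun s f => θ.Realize fun b => f (ρ s b) := by
  have ht := fun t : L.Term (β ⊕ Fin 0) => exists_term_code (M := M) (D := D) hN
    (fun s => Sum.elim (ρ s) Fin.elim0)
    (by rintro (b | b); exacts [hρ b, b.elim0]) (by rintro s hs (b | b); exacts [hD s hs b, b.elim0]) t
  have e : ∀ (f : ℕ → M) s, (fun b => f (Sum.elim (ρ s) Fin.elim0 b)) =
      Sum.elim (fun b => f (ρ s b)) (default : Fin 0 → M) := by
    intro f s
    funext b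
    rcases b with b | b
    exacts [rfl, b.elim0]
  change BoundedFormula.IsQF (n := 0) θ at hθ
  unfold Formula.Realize
  unfold Formula at θ
  induction hθ with
  | falsum => exact IsPrimrecFamily.falsum hN
  | of_isAtomic h =>
    cases h with
    | equal t₁ t₂ =>
      obtain ⟨l₁, hl₁, h₁⟩ := ht t₁
      obtain ⟨l₂, hl₂, h₂⟩ := ht t₂
      refine ⟨fun s => [2 * l₁ s, 2 * l₂ s], Primrec.list_cons.comp
        (Primrec.nat_mul.comp (.const 2) hl₁) (Primrec.list_cons.comp
          (Primrec.nat_mul.comp (.const 2) hl₂) (.const [])), fun s hs => ?_⟩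
      obtain ⟨t₁', e₁, r₁⟩ := h₁ s hs
      obtain ⟨t₂', e₂, r₂⟩ := h₂ s hs
      refine ⟨.equal t₁' t₂', ?_, fun f => ?_⟩
      · simp only [BoundedFormula.listEncode, List.map_cons, List.map_nil, encode_inl, e₁, e₂]
      · simp only [BoundedFormula.Realize, r₁, r₂, Term.bdEqual, e]
    | @rel n R ts =>
      choose l hl h using fun i => ht (ts i)
      have aux : ∀ I : List (Fin n), Primrec fun s => I.map fun i => 2 * l i s := by
        intro I
        induction I with
        | nil => exact .const []
        | cons i I ih =>
          exact Primrec.list_cons.comp (Primrec.nat_mul.comp (.const 2) (hl i)) ih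
      refine ⟨fun s => (2 * (2 * encode (⟨n, R⟩ : Σ k, L.Relations k)) + 1) ::
          (2 * (2 * N s + 1) + 1) :: (List.finRange n).map fun i => 2 * l i s,
        Primrec.list_cons.comp (.const _) (Primrec.list_cons.comp (Primrec.succ.comp
          (Primrec.nat_mul.comp (.const 2) (Primrec.succ.comp
            (Primrec.nat_mul.comp (.const 2) hN)))) (aux _)), fun s hs => ?_⟩
      choose t' e' r' using fun i => h i s hs
      refine ⟨.rel R t', ?_, fun f => ?_⟩
      · simp only [BoundedFormula.listEncode, List.map_cons, List.map_map, encode_inr, encode_inl, encode_nat, List.cons_append, List.nil_append]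
        congr 3
        funext i
        simp only [Function.comp_apply, encode_inl, e']
      · simp only [BoundedFormula.Realize, r', Relations.boundedFormula, e]
  | imp _ _ ih₁ ih₂ =>
    exact (ih₁.imp ih₂).congr fun s _ f => by rw [BoundedFormula.realize_imp]

theorem var_eq (hN : Primrec N) {i j : σ → ℕ} (hi : Primrec i) (hj : Primrec j)
    (hiD : ∀ s, D s → i s < K + N s) (hjD : ∀ s, D s → j s < K + N s) :
    IsPrimrecFamily L M K D N fun s f => f (i s) = f (j s) := by
  refine (realize_qf (L := L) (M := M) (D := D) hN (fun s (b : Bool) => bif b then i s else j s)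
    (by rintro (_ | _); exacts [hj, hi]) (by rintro s hs (_ | _); exacts [hjD s hs, hiD s hs])
    (θ := (Term.var true).equal (Term.var false))
    (BoundedFormula.IsAtomic.equal _ _).isQF).congr fun s _ f => ?_
  simp

end IsPrimrecFamily

theorem goedelNumber_eq_encode_map {k : ℕ} (ψ : L.Formula (Fin k)) :
    goedelNumber L ψ = encode (ψ.listEncode.map encode) := by
  unfold goedelNumber
  generalize BoundedFormula.listEncode ψ = I
  induction I with
  | nil => rfl
  | cons x I ih => simp [ih]

theorem length_le_encode (l : List ℕ) : l.length ≤ encode l := by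
  induction l with
  | nil => simp
  | cons x l ih =>
    rw [encode_list_cons, List.length_cons]
    exact Nat.succ_le_succ (ih.trans (Nat.right_le_pair _ _))

/-- The members of a primitive recursive family of predicates without bound variables can be
defined by the members of a recursive set of formulas. -/
theorem IsPrimrecFamily.exists_isRecursiveSet {K : ℕ} {P : ℕ → (ℕ → M) → Prop}
    (h : IsPrimrecFamily L M K (fun _ => True) (fun _ => 0) P) :
    ∃ ψ : ℕ → L.Formula (Fin K), IsRecursiveSet L (Set.range ψ) ∧
      ∀ d (f : ℕ → M), (ψ d).Realize (fun i => f i) ↔ P d f := by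
  obtain ⟨l, hl, h⟩ := h
  have hN : Primrec fun _ : ℕ => 0 := .const 0
  -- Craig's trick: `d` copies of a tautology are prefixed as premises to the `d`-th formula. Its
  -- code is then at least `d`, so membership of a number `e` in the set of codes is decided by a
  -- search over `d ≤ e`.
  obtain ⟨l', hl', h', hd⟩ : ∃ l' : ℕ → List ℕ, Primrec l' ∧
      (∀ d, IsCode L M K 0 (l' d) (P d)) ∧ ∀ d, d ≤ (l' d).length := by
    refine ⟨fun d => (List.range d).flatMap (fun _ => 3 :: (3 :: ([falsumCode 0] ++ [falsumCode 0])))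
      ++ l d, Primrec.list_append.comp (Primrec.list_flatMap Primrec.list_range
        (Primrec.const _).to₂) hl, fun d => ?_, fun d => ?_⟩
    · exact ((h d trivial).forall_imp (List.range d) (P := fun _ _ => ¬ False)
        fun _ _ => (IsCode.falsum K 0).not).congr fun f => by simp
    · simp [List.length_flatMap]
      omega
  choose ψ e r using h'
  refine ⟨ψ, ?_, fun d f => ?_⟩
  · have h1 : PrimrecRel fun d e : ℕ => encode (l' d) = e :=
      Primrec.eq.comp (Primrec.encode.comp (hl'.comp .fst)) .snd
    have h2 : PrimrecPred fun e : ℕ => ∃ d < e + 1, encode (l' d) = e :=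
      h1.exists_lt.comp Primrec.succ .id
    refine ComputablePred.of_eq h2.computablePred fun x => ?_
    simp only [Set.mem_image, Set.mem_range, exists_exists_eq_and, goedelNumber_eq_encode_map, e]
    constructor
    · rintro ⟨d, -, h⟩
      exact ⟨d, h⟩
    · rintro ⟨d, rfl⟩
      exact ⟨d, Nat.lt_succ_of_le ((hd d).trans (length_le_encode _)), rfl⟩
  · rw [← r, Formula.Realize, Subsingleton.elim default fun i : Fin 0 => f (K + i)]

end Coding

/-! ### Recursive saturation for several variables. -/

section Saturation

variable {L : FirstOrder.Language.{a, b}} {M : Type c} [L.Structure M]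
  [Encodable (Σ k, L.Functions k)] [Encodable (Σ k, L.Relations k)]

/-- A recursively saturated structure realizes recursive types in several variables. -/
theorem IsRecursivelySaturated.exists_forall (hM : IsRecursivelySaturated L M) {B : ℕ}
    {Q : ℕ → (ℕ → M) → Prop}
    (hQ : ∀ K ≤ B, IsPrimrecFamily L M K (fun _ => True) (fun _ => B - K) Q)
    (hanti : ∀ d f, Q (d + 1) f → Q d f) {A : ℕ} (hAB : A ≤ B) (f : ℕ → M)
    (h : ∀ d, ∃ g : ℕ → M, (∀ v < A, g v = f v) ∧ Q d g) :
    ∃ g : ℕ → M, (∀ v < A, g v = f v) ∧ ∀ d, Q d g := by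
  induction hAB using Nat.decreasingInduction generalizing f with
  | self =>
    -- All variables on which `Q` depends already have values, so each witness may be replaced by
    -- `f`.
    refine ⟨f, fun _ _ => rfl, fun d => ?_⟩
    obtain ⟨g, hg, hd⟩ := h d
    obtain ⟨l, -, hl⟩ := hQ B le_rfl
    exact ((hl d trivial).congr_val fun v hv => hg v (by simpa using hv)).1 hd
  | of_succ A hA ih =>
    -- The variables after number `A` are quantified away. What remains is a recursive type in the
    -- variable `A` over the parameters below it. Realizing it leaves the same problem with one more
    -- variable fixed.
    have hfam : IsPrimrecFamily L M (A + 1) (fun _ => True) (fun _ => 0)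
        fun d f => ∃ g : ℕ → M, (∀ v < A + 1, g v = f v) ∧ Q d g :=
      IsPrimrecFamily.exs (r := fun _ => B - (A + 1)) (.const 0) (.const _)
        (by simpa using hQ (A + 1) hA)
    obtain ⟨ψ, hψ, hr⟩ := hfam.exists_isRecursiveSet
    have hsnoc : ∀ y : M, (Fin.snoc (fun i : Fin A => f i) y : Fin (A + 1) → M) =
        fun i : Fin (A + 1) => Function.update f A y i := by
      intro y
      funext i
      refine Fin.lastCases ?_ (fun j => ?_) i
      · simp
      · rw [Fin.snoc_castSucc, Fin.val_castSucc, Function.update_of_ne (by omega)]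
    -- Since the predicates decrease, a witness for the `d`-th one satisfies the whole finite part
    -- of the type up to `d`.
    have hanti' : ∀ d f m, m ≤ d → Q d f → Q m f := fun d f m hm hd =>
      Nat.decreasingInduction (motive := fun k _ => Q k f) (fun k _ => hanti k f) hd hm
    obtain ⟨y, hy⟩ := hM A ψ hψ (fun i => f i) fun d => by
      obtain ⟨g, hg, hd⟩ := h d
      refine ⟨g A, fun m hm => ?_⟩
      rw [hsnoc, hr]
      refine ⟨g, fun v hv => ?_, hanti' d g m hm hd⟩
      obtain rfl | hne := eq_or_ne v A
      · simp
      · rw [Function.update_of_ne hne]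
        exact hg v (by omega)
    obtain ⟨g, hg, hd⟩ := ih (Function.update f A y) fun d => by
      have := hy d
      rwa [hsnoc, hr] at this
    refine ⟨g, fun v hv => ?_, hd⟩
    rw [hg v (by omega), Function.update_of_ne (by omega)]

end Saturation

/-! ### The approximations as predicates of assignments, and their codes. -/

namespace NormalForm

variable {L : FirstOrder.Language.{a, b}} (φ : NormalForm L) {M : Type c} [L.Structure M]

/-- The number of indices of the level before level `n`. -/
def slots : ℕ → ℕ
  | 0 => 0
  | n + 1 => φ.p n + n + 1

/-- The number of indices of level `n` to which the part of `Ψ^n` on the independence atoms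
refers by `j` and `k`. -/
def atomSlots (n : ℕ) : ℕ := if n = 0 then 0 else φ.slots n + 1

/-- The length of the tuples `x_{n,i} y_{n,i}`. -/
def width : ℕ := φ.lenX + φ.lenY

/-- The number of a variable when the tuples `x_{n,i} y_{n,i}` are written one after the other. -/
def varAt (s : ℕ) (z : Fin φ.lenX ⊕ Fin φ.lenY) : ℕ :=
  s * φ.width + Sum.elim (fun c : Fin φ.lenX => (c : ℕ)) (fun c : Fin φ.lenY => φ.lenX + c) z

/-- `Ψ^n` as a predicate of assignments to the variables of level `n` numbered by `varAt`. -/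
def PsiHolds (n : ℕ) (f : ℕ → M) : Prop :=
  (∀ s < φ.slots (n + 1), φ.θ.Realize fun z => f (φ.varAt s z)) ∧
  ∀ i : Fin φ.numAtoms, ∀ j < φ.atomSlots n, ∀ k < φ.atomSlots n,
    (φ.w i ≠ [] ∧ ¬ ∀ c ∈ φ.w i, f (φ.varAt j (.inr c)) = f (φ.varAt k (.inr c))) ∨
    ∃ l < φ.slots (n + 1) - (φ.slots n + 1),
      (∀ c ∈ φ.u i, f (φ.varAt j (.inr c)) = f (φ.varAt (φ.slots n + 1 + l) (.inr c))) ∧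
      (∀ c ∈ φ.v i, f (φ.varAt k (.inr c)) = f (φ.varAt (φ.slots n + 1 + l) (.inr c))) ∧
      ∀ c ∈ φ.w i, f (φ.varAt j (.inr c)) = f (φ.varAt (φ.slots n + 1 + l) (.inr c))

/-- The approximation consisting of the `d` levels from level `n` on, as a predicate of
assignments. -/
def ApproxHolds : ℕ → ℕ → (ℕ → M) → Prop
  | 0, _, _ => True
  | d + 1, n, f => ∀ g : ℕ → M, (∀ v < φ.slots n * φ.width, g v = f v) →
      ∃ h : ℕ → M, (∀ v < φ.slots n * φ.width + φ.lenX, h v = g v) ∧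
        φ.PsiHolds n h ∧ ApproxHolds d (n + 1) h

theorem p_le_p_succ (n : ℕ) : φ.p n ≤ φ.p (n + 1) := Nat.le_add_right _ _

theorem slots_lt_slots_succ (n : ℕ) : φ.slots n < φ.slots (n + 1) := by
  cases n with
  | zero => simp [slots]
  | succ n =>
    have := φ.p_le_p_succ n
    simp only [slots]
    omega

theorem atomSlots_le (n : ℕ) : φ.atomSlots n ≤ φ.slots (n + 1) := by
  have := φ.slots_lt_slots_succ n
  unfold atomSlots
  split <;> omega

theorem offset_lt_width (z : Fin φ.lenX ⊕ Fin φ.lenY) :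
    Sum.elim (fun c : Fin φ.lenX => (c : ℕ)) (fun c : Fin φ.lenY => φ.lenX + c) z < φ.width := by
  rcases z with z | z <;> simp only [Sum.elim_inl, Sum.elim_inr, width] <;> omega

theorem varAt_lt {s S : ℕ} (h : s < S) (z : Fin φ.lenX ⊕ Fin φ.lenY) :
    φ.varAt s z < S * φ.width := by
  have h1 := φ.offset_lt_width z
  have h2 : (s + 1) * φ.width ≤ S * φ.width := Nat.mul_le_mul_right _ h
  rw [Nat.add_mul, one_mul] at h2
  unfold varAt
  omega

theorem slots_mul_width_add_lenX_le (n : ℕ) :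
    φ.slots n * φ.width + φ.lenX ≤ φ.slots (n + 1) * φ.width := by
  have h2 : (φ.slots n + 1) * φ.width ≤ φ.slots (n + 1) * φ.width :=
    Nat.mul_le_mul_right _ (φ.slots_lt_slots_succ n)
  rw [Nat.add_mul, one_mul] at h2
  have : φ.lenX ≤ φ.width := Nat.le_add_right _ _
  omega

section Primrec

open Primrec (nat_add nat_mul nat_rec₁ fst snd succ pred)

theorem primrec_p : Primrec φ.p := by
  have h : Primrec₂ fun (n q : ℕ) => q + φ.numAtoms * ((q + (n + 1) + 1) * (q + (n + 1) + 1)) := by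
    have h1 : Primrec fun x : ℕ × ℕ => x.2 + (x.1 + 1) + 1 :=
      succ.comp (nat_add.comp snd (succ.comp fst))
    exact nat_add.comp snd (nat_mul.comp (.const _) (nat_mul.comp h1 h1))
  refine (nat_rec₁ 0 h).of_eq fun n => ?_
  induction n with
  | zero => rfl
  | succ n ih => simp only [ih, p, sq]

theorem primrec_slots : Primrec φ.slots := by
  have h : Primrec fun n => if n = 0 then 0 else φ.p (n - 1) + n :=
    .ite (Primrec.eq.comp .id (.const 0)) (.const 0) (nat_add.comp (φ.primrec_p.comp pred) .id)
  refine h.of_eq fun n => ?_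
  cases n <;> simp [slots, add_assoc]

theorem primrec_atomSlots : Primrec φ.atomSlots :=
  .ite (Primrec.eq.comp .id (.const 0)) (.const 0) (succ.comp φ.primrec_slots)

theorem primrec_varAt (z : Fin φ.lenX ⊕ Fin φ.lenY) : Primrec fun s => φ.varAt s z :=
  nat_add.comp (nat_mul.comp .id (.const _)) (.const _)

end Primrec

section Families

variable [Encodable (Σ k, L.Functions k)] [Encodable (Σ k, L.Relations k)]

theorem isPrimrecFamily_tuple_eq {σ : Type*} [Primcodable σ] {K : ℕ} {D : σ → Prop} {N : σ → ℕ}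
    (hN : Primrec N) {i j : σ → ℕ} (hi : Primrec i) (hj : Primrec j)
    (hiD : ∀ s, D s → (i s + 1) * φ.width ≤ K + N s)
    (hjD : ∀ s, D s → (j s + 1) * φ.width ≤ K + N s) (e : List (Fin φ.lenY)) :
    IsPrimrecFamily L M K D N fun s f =>
      ∀ c ∈ e, f (φ.varAt (i s) (.inr c)) = f (φ.varAt (j s) (.inr c)) :=
  .forall_mem_list hN e fun _ _ => .var_eq hN ((φ.primrec_varAt _).comp hi)
    ((φ.primrec_varAt _).comp hj)
    (fun s hs => (φ.varAt_lt (Nat.lt_succ_self _) _).trans_le (hiD s hs))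
    (fun s hs => (φ.varAt_lt (Nat.lt_succ_self _) _).trans_le (hjD s hs))

theorem isPrimrecFamily_psiHolds (K : ℕ) :
    IsPrimrecFamily L M K (fun _ => True) (fun n => φ.slots (n + 1) * φ.width - K)
      φ.PsiHolds := by
  have hN : Primrec fun n => φ.slots (n + 1) * φ.width - K :=
    Primrec.nat_sub.comp (Primrec.nat_mul.comp (φ.primrec_slots.comp .succ) (.const _)) (.const _)
  have hle : ∀ {n s : ℕ}, s < φ.slots (n + 1) →
      (s + 1) * φ.width ≤ K + (φ.slots (n + 1) * φ.width - K) := fun {n s} h => by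
    have : (s + 1) * φ.width ≤ φ.slots (n + 1) * φ.width := Nat.mul_le_mul_right _ h
    omega
  have hθ : IsPrimrecFamily L M K (fun _ => True) (fun n => φ.slots (n + 1) * φ.width - K)
      fun n f => ∀ s < φ.slots (n + 1), φ.θ.Realize fun z => f (φ.varAt s z) :=
    .forall_lt (P := fun x f => φ.θ.Realize fun z => f (φ.varAt x.2 z)) hN
      (φ.primrec_slots.comp .succ) (.realize_qf (hN.comp .fst) (fun x z => φ.varAt x.2 z)
        (fun z => (φ.primrec_varAt z).comp .snd)
        (fun x hx z => (φ.varAt_lt (Nat.lt_succ_self _) z).trans_le (hle hx.2)) φ.θ_isQF)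
  refine hθ.and hN (.forall_fin hN fun i => ?_)
  have hA := φ.primrec_atomSlots
  have hA' := φ.atomSlots_le
  have hN1 : Primrec fun x : ℕ × ℕ => φ.slots (x.1 + 1) * φ.width - K := hN.comp .fst
  have hN2 : Primrec fun x : (ℕ × ℕ) × ℕ => φ.slots (x.1.1 + 1) * φ.width - K := hN1.comp .fst
  have hN3 : Primrec fun x : ((ℕ × ℕ) × ℕ) × ℕ => φ.slots (x.1.1.1 + 1) * φ.width - K :=
    hN2.comp .fst
  have hl : Primrec fun x : ((ℕ × ℕ) × ℕ) × ℕ => φ.slots x.1.1.1 + 1 + x.2 :=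
    Primrec.nat_add.comp (Primrec.succ.comp (φ.primrec_slots.comp
      (Primrec.fst.comp (Primrec.fst.comp .fst)))) .snd
  have hj : Primrec fun x : ((ℕ × ℕ) × ℕ) × ℕ => x.1.1.2 :=
    Primrec.snd.comp (Primrec.fst.comp .fst)
  have hk : Primrec fun x : ((ℕ × ℕ) × ℕ) × ℕ => x.1.2 := Primrec.snd.comp .fst
  let D (x : (ℕ × ℕ) × ℕ) : Prop :=
    (True ∧ x.1.2 < φ.atomSlots x.1.1) ∧ x.2 < φ.atomSlots x.1.1
  let B (x : (ℕ × ℕ) × ℕ) : ℕ := φ.slots (x.1.1 + 1) - (φ.slots x.1.1 + 1)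
  let D' (x : ((ℕ × ℕ) × ℕ) × ℕ) : Prop := D x.1 ∧ x.2 < B x.1
  have hB : Primrec B := Primrec.nat_sub.comp
    (φ.primrec_slots.comp (Primrec.succ.comp (Primrec.fst.comp .fst)))
    (Primrec.succ.comp (φ.primrec_slots.comp (Primrec.fst.comp .fst)))
  have hjD : ∀ x, D' x → (x.1.1.2 + 1) * φ.width ≤
      K + (φ.slots (x.1.1.1 + 1) * φ.width - K) :=
    fun x hx => hle (hx.1.1.2.trans_le (hA' _))
  have hkD : ∀ x, D' x → (x.1.2 + 1) * φ.width ≤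
      K + (φ.slots (x.1.1.1 + 1) * φ.width - K) :=
    fun x hx => hle (hx.1.2.trans_le (hA' _))
  have hlD : ∀ x, D' x → (φ.slots x.1.1.1 + 1 + x.2 + 1) * φ.width ≤
      K + (φ.slots (x.1.1.1 + 1) * φ.width - K) :=
    fun x hx => hle (by have : x.2 < φ.slots (x.1.1.1 + 1) - _ := hx.2; omega)
  have hl' := IsPrimrecFamily.exists_lt hN2 hB <|
    (φ.isPrimrecFamily_tuple_eq (M := M) hN3 hj hl hjD hlD (φ.u i)).and hN3 <|
    (φ.isPrimrecFamily_tuple_eq hN3 hk hl hkD hlD (φ.v i)).and hN3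
      (φ.isPrimrecFamily_tuple_eq hN3 hj hl hjD hlD (φ.w i))
  have hw := (IsPrimrecFamily.const (L := L) (M := M) (D := D) hN2 (φ.w i ≠ [])).and hN2
    ((φ.isPrimrecFamily_tuple_eq hN2 (Primrec.snd.comp .fst) .snd
      (fun x hx => hle (hx.1.2.trans_le (hA' _)))
      (fun x hx => hle (hx.2.trans_le (hA' _))) (φ.w i)).not hN2)
  have hk' := IsPrimrecFamily.forall_lt
    (D := fun x : ℕ × ℕ => True ∧ x.2 < φ.atomSlots x.1) hN1 (hA.comp .fst) (hw.or hN2 hl')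
  exact IsPrimrecFamily.forall_lt (D := fun _ => True) hN hA hk'

end Families

/-- The recursion for `x` changes its second argument and so is not a primitive recursion in `d` for
fixed `n`. Unwinding gives an explicit form: the left parts in order, the middle, then the right
parts in reverse order. -/
theorem primrec_nested {l m r : ℕ → List ℕ} (hl : Primrec l) (hm : Primrec m) (hr : Primrec r)
    (x : ℕ → ℕ → List ℕ) (h0 : ∀ n, x 0 n = m n)
    (h1 : ∀ d n, x (d + 1) n = l n ++ (x d (n + 1) ++ r n)) (n : ℕ) :
    Primrec fun d => x d n := by
  have key : ∀ d n, x d n = (List.range d).flatMap (fun i => l (n + i)) ++ (m (n + d) ++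
      (List.range d).reverse.flatMap fun i => r (n + i)) := by
    intro d
    induction d with
    | zero => simp [h0]
    | succ d ih =>
      intro n
      have e : ∀ i, n + 1 + i = n + (i + 1) := fun i => by omega
      rw [h1, ih]
      simp [List.range_succ_eq_map, List.flatMap_map, ← List.map_reverse, e]
  have hadd : Primrec₂ fun (_ i : ℕ) => n + i := Primrec.nat_add.comp (.const n) .snd
  refine Primrec.of_eq (Primrec.list_append.comp
    (Primrec.list_flatMap Primrec.list_range (Primrec.to₂ (hl.comp hadd))) (Primrec.list_append.comp
      (hm.comp (Primrec.nat_add.comp (.const n) .id)) (Primrec.list_flatMap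
        (Primrec.list_reverse.comp Primrec.list_range) (Primrec.to₂ (hr.comp hadd))))) fun d => (key d n).symm

section Families

variable [Encodable (Σ k, L.Functions k)] [Encodable (Σ k, L.Relations k)]

theorem isPrimrecFamily_approxHolds {K n : ℕ} (hK : K ≤ φ.slots n * φ.width) :
    IsPrimrecFamily L M K (fun _ => True) (fun _ => φ.slots n * φ.width - K)
      fun d => φ.ApproxHolds d n := by
  obtain ⟨l, hl, h⟩ := φ.isPrimrecFamily_psiHolds (M := M) K
  let N := fun n => φ.slots n * φ.width - K
  let r := fun n => φ.slots (n + 1) * φ.width - (φ.slots n * φ.width + φ.lenX)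
  -- Here `7` and `3` code the universal quantifier and implication. One level is written `∀ … ¬ ∀ …
  -- (Ψ → ¬ …)`; the deeper levels come between `left` and `right`, and `right` consists of the two
  -- `⊥` that complete the negations.
  let left := fun n => List.replicate φ.lenX 7 ++ 3 :: (List.replicate (r n) 7 ++
    3 :: (l n ++ [3]))
  let right := fun n => [falsumCode (N (n + 1)), falsumCode (N n + φ.lenX)]
  let mid := fun n => 3 :: ([falsumCode (N n)] ++ [falsumCode (N n)])
  let x : ℕ → ℕ → List ℕ := fun d => Nat.rec mid
    (fun _ y n => left n ++ (y (n + 1) ++ right n)) d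
  have hw : Primrec fun n => φ.slots n * φ.width :=
    Primrec.nat_mul.comp φ.primrec_slots (.const _)
  have hN : Primrec N := Primrec.nat_sub.comp hw (.const K)
  have hr : Primrec r := Primrec.nat_sub.comp (hw.comp .succ) (Primrec.nat_add.comp hw (.const _))
  have hf := IsPrimrecFamily.primrec_falsumCode
  have hmid : Primrec mid := Primrec.list_cons.comp (.const 3) (Primrec.list_append.comp
    (IsPrimrecFamily.primrec_falsumCode_singleton hN)
    (IsPrimrecFamily.primrec_falsumCode_singleton hN))
  have hright : Primrec right := Primrec.list_cons.comp (hf.comp (hN.comp .succ))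
    (IsPrimrecFamily.primrec_falsumCode_singleton (Primrec.nat_add.comp hN (.const _)))
  have hleft : Primrec left := Primrec.list_append.comp (.const _) (Primrec.list_cons.comp
    (.const 3) (Primrec.list_append.comp ((IsPrimrecFamily.primrec_replicate 7).comp hr)
      (Primrec.list_cons.comp (.const 3) (Primrec.list_append.comp hl (.const _)))))
  refine ⟨fun d => x d n, primrec_nested hleft hmid hright x (fun _ => rfl) (fun _ _ => rfl) n,
    fun d _ => ?_⟩
  induction d generalizing n with
  | zero => exact (IsCode.falsum K (N n)).not.congr fun f => by simp [ApproxHolds]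
  | succ d ih =>
    have hle := φ.slots_mul_width_add_lenX_le n
    have e : N n + φ.lenX + r n = N (n + 1) := by
      simp only [N, r]
      omega
    have h1 : IsCode L M K (N n + φ.lenX + r n) (3 :: (l n ++ 3 :: (x d (n + 1) ++
        [falsumCode (N (n + 1))]))) fun f => φ.PsiHolds n f → ¬ φ.ApproxHolds d (n + 1) f := by
      rw [e]
      exact (h n trivial).imp (IsCode.not (ih (by omega) trivial))
    have h2 := (IsCode.alls _ (IsCode.alls (r n) h1).not).congr (Q := φ.ApproxHolds (d + 1) n)
      fun f => by
        have e1 : K + N n = φ.slots n * φ.width := by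
          simp only [N]
          omega
        simp only [ApproxHolds, ← add_assoc, e1]
        simp
    have e2 : x (d + 1) n = left n ++ (x d (n + 1) ++ right n) := rfl
    beta_reduce
    rw [e2]
    simpa [left, right] using h2

end Families

theorem approxHolds_of_succ (d : ℕ) : ∀ (n : ℕ) (f : ℕ → M),
    φ.ApproxHolds (d + 1) n f → φ.ApproxHolds d n f := by
  induction d with
  | zero => exact fun _ _ _ => trivial
  | succ d ih =>
    intro n f h g hg
    obtain ⟨h', h1, h2, h3⟩ := h g hg
    exact ⟨h', h1, h2, ih _ _ h3⟩

/-- The use of saturation: the first `φ.slots n * φ.width + φ.lenX` variables, old values and the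
move of player I, are the parameters, and the answer of player II is the tuple to be found. -/
theorem exists_psiHolds_and_forall_approxHolds
    (hM : ∃ (_ : Encodable (Σ k, L.Functions k)) (_ : Encodable (Σ k, L.Relations k)),
      IsRecursivelySaturated L M) (n : ℕ) (f : ℕ → M)
    (h : ∀ d, ∃ g : ℕ → M, (∀ v < φ.slots n * φ.width + φ.lenX, g v = f v) ∧
      φ.PsiHolds n g ∧ φ.ApproxHolds d (n + 1) g) :
    ∃ g : ℕ → M, (∀ v < φ.slots n * φ.width + φ.lenX, g v = f v) ∧
      φ.PsiHolds n g ∧ ∀ d, φ.ApproxHolds d (n + 1) g := by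
  obtain ⟨_, _, hM⟩ := hM
  obtain ⟨g, hg, hd⟩ := hM.exists_forall (B := φ.slots (n + 1) * φ.width)
    (Q := fun d g => φ.PsiHolds n g ∧ φ.ApproxHolds d (n + 1) g)
    (fun K hK => .and (.const _) ((φ.isPrimrecFamily_psiHolds K).comp (.const n) (fun _ => id))
      (φ.isPrimrecFamily_approxHolds hK))
    (fun d g hg => ⟨hg.1, φ.approxHolds_of_succ _ _ _ hg.2⟩)
    (φ.slots_mul_width_add_lenX_le n) f h
  exact ⟨g, hg, (hd 0).1, fun d => (hd d).2⟩

end NormalForm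

theorem realize_eqTuple {L : FirstOrder.Language.{a, b}} {M : Type c} [L.Structure M] {α : Type}
    {s t : List α} (h : s.length = t.length) (f : α → M) :
    (eqTuple (L := L) s t).Realize f ↔ s.map f = t.map f := by
  induction s generalizing t with
  | nil =>
    obtain rfl := List.length_eq_zero_iff.1 h.symm
    simp [eqTuple]
  | cons x s ih =>
    obtain _ | ⟨y, t⟩ := t
    · simp at h
    · have := ih (t := t) (by simpa using h)
      simp only [eqTuple, List.zipWith_cons_cons, List.foldr_cons, Formula.realize_inf,
        List.map_cons, List.cons.injEq, Formula.realize_equal, Term.realize_var] at this ⊢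
      rw [this]

/-! ### The numbering of the variables, and `Psi` in terms of it. -/

namespace NormalForm

variable {L : FirstOrder.Language.{a, b}} (φ : NormalForm L) {M : Type c}

/-- The position of the tuple `x_{n,i} y_{n,i}` in an enumeration of the tuples of level `n` which
begins with those whose indices occur in the levels before, followed by `x_{n,-n} y_{n,-n}`. -/
def slot : ℕ → ℤ → ℕ
  | 0, _ => 0
  | n + 1, i => if i = -(n + 1 : ℤ) then φ.slots (n + 1) else
      if i ≤ φ.p n then slot n i else (i + (n + 1)).toNat

theorem slot_succ {n : ℕ} {i : ℤ} (h : -(n : ℤ) ≤ i) (h' : i ≤ φ.p n) :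
    φ.slot (n + 1) i = φ.slot n i := by
  rw [slot, if_neg (by omega), if_pos h']

theorem slot_neg (n : ℕ) : φ.slot n (-n) = φ.slots n := by
  cases n with
  | zero => rfl
  | succ n => rw [slot, if_pos (by push_cast; rfl)]

theorem slot_of_p_lt {n : ℕ} {i : ℤ} (h : (φ.p n : ℤ) < i) :
    φ.slot (n + 1) i = (i + (n + 1)).toNat := by
  rw [slot, if_neg (by omega), if_neg (by omega)]

theorem slot_lt {n : ℕ} {i : ℤ} (h : -(n : ℤ) ≤ i) (h' : i ≤ φ.p n) :
    φ.slot n i < φ.slots (n + 1) := by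
  induction n with
  | zero => simp [slot, slots]
  | succ n ih =>
    have h1 := φ.slots_lt_slots_succ (n + 1)
    by_cases hi : i = -((n + 1 : ℕ) : ℤ)
    · rwa [hi, slot_neg]
    · by_cases hp : i ≤ φ.p n
      · rw [φ.slot_succ (by omega) hp]
        exact (ih (by omega) hp).trans h1
      · rw [φ.slot_of_p_lt (by omega)]
        simp only [slots]
        omega

/-- In the numbering, the tuples inspected for the independence atoms form an initial segment, the
old tuples and the one begun by player I; the tuples that may serve as witnesses come after it. -/
theorem le_p_iff {n : ℕ} {i : ℤ} (h : -((n + 1 : ℕ) : ℤ) ≤ i) :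
    i ≤ φ.p n ↔ φ.slot (n + 1) i < φ.slots (n + 1) + 1 := by
  by_cases hp : i ≤ φ.p n
  · refine iff_of_true hp ?_
    by_cases hi : i = -((n + 1 : ℕ) : ℤ)
    · rw [hi, slot_neg]
      exact Nat.lt_succ_self _
    · rw [φ.slot_succ (by omega) hp]
      exact (φ.slot_lt (by omega) hp).trans (Nat.lt_succ_self _)
  · refine iff_of_false hp ?_
    rw [φ.slot_of_p_lt (by omega)]
    simp only [slots]
    omega

theorem slot_inj {n : ℕ} {i j : ℤ} (hi : -(n : ℤ) ≤ i) (hi' : i ≤ φ.p n) (hj : -(n : ℤ) ≤ j)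
    (hj' : j ≤ φ.p n) (h : φ.slot n i = φ.slot n j) : i = j := by
  induction n with
  | zero =>
    simp only [p] at hi' hj'
    omega
  | succ n ih =>
    -- The three kinds of indices (the new least one, the old ones, the new large ones) take values
    -- equal to, below and above `φ.slots (n + 1)`, respectively.
    have key : ∀ i : ℤ, -((n + 1 : ℕ) : ℤ) ≤ i → (i = -((n + 1 : ℕ) : ℤ) ∧
        φ.slot (n + 1) i = φ.slots (n + 1)) ∨ (-(n : ℤ) ≤ i ∧ i ≤ φ.p n ∧
        φ.slot (n + 1) i = φ.slot n i ∧ φ.slot n i < φ.slots (n + 1)) ∨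
        ((φ.p n : ℤ) < i ∧ φ.slot (n + 1) i = (i + (n + 1)).toNat) := by
      intro i h
      by_cases hi : i = -((n + 1 : ℕ) : ℤ)
      · exact .inl ⟨hi, by rw [hi, slot_neg]⟩
      · by_cases hp : i ≤ φ.p n
        · exact .inr (.inl ⟨by omega, hp, φ.slot_succ (by omega) hp, φ.slot_lt (by omega) hp⟩)
        · exact .inr (.inr ⟨by omega, φ.slot_of_p_lt (by omega)⟩)
    have hs : φ.slots (n + 1) = φ.p n + n + 1 := rfl
    rcases key i hi with h1 | h1 | h1 <;> rcases key j hj with h2 | h2 | h2 <;>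
      omega

theorem exists_slot_eq {n s : ℕ} (h : s < φ.slots (n + 1)) :
    ∃ i : ℤ, (-(n : ℤ) ≤ i ∧ i ≤ φ.p n) ∧ φ.slot n i = s := by
  induction n with
  | zero =>
    simp only [slots, p] at h
    exact ⟨0, by simp [p], by simp only [slot]; omega⟩
  | succ n ih =>
    have hp := φ.p_le_p_succ n
    obtain h1 | rfl | h1 := lt_trichotomy s (φ.slots (n + 1))
    · obtain ⟨i, hi, e⟩ := ih h1
      exact ⟨i, by omega, by rw [φ.slot_succ hi.1 hi.2, e]⟩
    · exact ⟨_, by omega, φ.slot_neg (n + 1)⟩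
    · simp only [slots] at h h1
      refine ⟨s - (n + 1), by omega, ?_⟩
      rw [φ.slot_of_p_lt (by omega)]
      omega

theorem varAt_inj {s s' : ℕ} {z z' : Fin φ.lenX ⊕ Fin φ.lenY}
    (h : φ.varAt s z = φ.varAt s' z') : s = s' ∧ z = z' := by
  have key : ∀ {s s' z z'}, φ.varAt s z = φ.varAt s' z' → ¬ s < s' := fun {s s' z z'} h hs => by
    have h1 := φ.varAt_lt hs z
    have h2 : s' * φ.width ≤ φ.varAt s' z' := Nat.le_add_right _ _
    omega
  obtain rfl : s = s' := by
    have := key h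
    have := key h.symm
    omega
  refine ⟨rfl, ?_⟩
  rcases z with z | z <;> rcases z' with z' | z' <;>
    simp only [varAt, Sum.elim_inl, Sum.elim_inr] at h
  · exact congrArg _ (Fin.ext (by omega))
  · omega
  · omega
  · exact congrArg _ (Fin.ext (by omega))

theorem exists_varAt_eq {S v : ℕ} (h : v < S * φ.width) : ∃ s z, s < S ∧ φ.varAt s z = v := by
  have hw : 0 < φ.width := Nat.pos_of_ne_zero fun h0 => by simp [h0] at h
  have h1 := Nat.div_add_mod v φ.width
  have h2 := Nat.mod_lt v hw
  rw [mul_comm] at h1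
  refine ⟨v / φ.width, if hz : v % φ.width < φ.lenX then .inl ⟨_, hz⟩ else
    .inr ⟨v % φ.width - φ.lenX, by simp only [width] at *; omega⟩,
    (Nat.div_lt_iff_lt_mul hw).2 h, ?_⟩
  unfold varAt
  split <;> simp only [Sum.elim_inl, Sum.elim_inr] <;> omega

/-- The number of a variable of level `n`. -/
def code (n : ℕ) (z : φ.LevelVar n) : ℕ := φ.varAt (φ.slot n z.1.1) z.2

/-- The number of a variable of the level before level `n`. -/
def codePrev : ∀ n : ℕ, φ.PrevVar n → ℕ
  | 0 => Empty.elim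
  | n + 1 => φ.code n

theorem Idx.bounds {n : ℕ} (i : φ.Idx n) : -(n : ℤ) ≤ i.1 ∧ i.1 ≤ φ.p n := Finset.mem_Icc.1 i.2

theorem code_injective (n : ℕ) : Function.Injective (φ.code n) := by
  rintro ⟨i, z⟩ ⟨j, z'⟩ h
  obtain ⟨h1, rfl⟩ := φ.varAt_inj h
  have hi := i.bounds
  have hj := j.bounds
  rw [Subtype.ext (φ.slot_inj hi.1 hi.2 hj.1 hj.2 h1)]

theorem exists_code_eq {n v : ℕ} (h : v < φ.slots (n + 1) * φ.width) : ∃ z, φ.code n z = v := by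
  obtain ⟨s, z, hs, rfl⟩ := φ.exists_varAt_eq h
  obtain ⟨i, hi, rfl⟩ := φ.exists_slot_eq hs
  exact ⟨(⟨i, Finset.mem_Icc.2 hi⟩, z), rfl⟩

theorem codePrev_lt {n : ℕ} (z : φ.PrevVar n) : φ.codePrev n z < φ.slots n * φ.width := by
  cases n with
  | zero => exact z.elim
  | succ n => exact φ.varAt_lt (φ.slot_lt z.1.bounds.1 z.1.bounds.2) _

theorem codePrev_injective (n : ℕ) : Function.Injective (φ.codePrev n) := by
  cases n with
  | zero => exact fun z => z.elim
  | succ n => exact φ.code_injective n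

theorem exists_codePrev_eq {n v : ℕ} (h : v < φ.slots n * φ.width) :
    ∃ z, φ.codePrev n z = v := by
  cases n with
  | zero => simp [slots] at h
  | succ n => exact φ.exists_code_eq h

theorem code_of_isUniversal {n : ℕ} {z : φ.LevelVar n} (h : φ.IsUniversal n z) :
    φ.slots n * φ.width ≤ φ.code n z ∧ φ.code n z < φ.slots n * φ.width + φ.lenX := by
  obtain ⟨i, z | z⟩ := z
  · have hi : i.1 = -n := h.1
    simp only [code, hi, slot_neg, varAt, Sum.elim_inl]
    omega
  · simp [IsUniversal] at h

theorem exists_isUniversal_code_eq {n v : ℕ} (h : φ.slots n * φ.width ≤ v)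
    (h' : v < φ.slots n * φ.width + φ.lenX) : ∃ z, φ.IsUniversal n z ∧ φ.code n z = v := by
  refine ⟨(⟨-n, Finset.mem_Icc.2 ⟨le_rfl, by omega⟩⟩, .inl ⟨v - φ.slots n * φ.width, by omega⟩),
    ⟨rfl, rfl⟩, ?_⟩
  simp only [code, slot_neg, varAt, Sum.elim_inl]
  omega

theorem code_lift {n : ℕ} (z : φ.LevelVar n) :
    φ.code (n + 1) (φ.liftIdx z.1, z.2) = φ.code n z := by
  simp only [code, liftIdx, φ.slot_succ z.1.bounds.1 z.1.bounds.2]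

variable [L.Structure M]

/-- An old variable and its copy at the next level have the same number by `code_lift`, so the
equalities in `Psi` turn into agreement of `f` with the previous position `v`. -/
theorem realize_psi {n : ℕ} (v : φ.PrevVar n → M) (f : ℕ → M) :
    (φ.Psi n).Realize (Sum.elim v fun z => f (φ.code n z)) ↔
      (∀ z, f (φ.codePrev n z) = v z) ∧ φ.PsiHolds n f := by
  cases n with
  | zero =>
    simp only [Psi, thetaAt, Formula.realize_relabel, PsiHolds, atomSlots]
    simp [slots, p, Function.comp_def, code, slot]
  | succ n =>
    simp only [Psi, Formula.realize_inf, Formula.realize_iInf, Formula.realize_iSup,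
      Formula.realize_sup]
    have h1 : (∀ i : φ.Idx (n + 1), (φ.thetaAt i).Realize
        (Sum.elim v fun z => f (φ.code (n + 1) z))) ↔
        ∀ s < φ.slots (n + 1 + 1), φ.θ.Realize fun z => f (φ.varAt s z) := by
      simp only [thetaAt, Formula.realize_relabel]
      constructor
      · intro h s hs
        obtain ⟨i, hi, rfl⟩ := φ.exists_slot_eq hs
        exact h ⟨i, Finset.mem_Icc.2 hi⟩
      · intro h i
        exact h _ (φ.slot_lt i.bounds.1 i.bounds.2)
    have h2 : (∀ z : φ.LevelVar n, ((Term.var (Sum.inr (φ.liftIdx z.1, z.2))).equal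
        (Term.var (Sum.inl z)) : L.Formula (φ.PrevVar (n + 1) ⊕ φ.LevelVar (n + 1))).Realize
        (Sum.elim v fun z => f (φ.code (n + 1) z))) ↔
        ∀ z, f (φ.codePrev (n + 1) z) = v z := by
      simp only [Formula.realize_equal, Term.realize_var, Sum.elim_inl, Sum.elim_inr, code_lift]
      rfl
    have hmap : ∀ (e : List (Fin φ.lenY)) (i : φ.Idx (n + 1)), (φ.tup e i).map
        (Sum.elim v fun z => f (φ.code (n + 1) z)) =
        e.map fun c => f (φ.varAt (φ.slot (n + 1) i.1) (.inr c)) := by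
      intro e i
      simp [tup, code, Function.comp_def]
    have h3 : ∀ (i : Fin φ.numAtoms) (j k : φ.Idx (n + 1)), (φ.piAt i j k).Realize
        (Sum.elim v fun z => f (φ.code (n + 1) z)) ↔ φ.w i ≠ [] ∧ ¬ ∀ c ∈ φ.w i,
          f (φ.varAt (φ.slot (n + 1) j.1) (.inr c)) =
            f (φ.varAt (φ.slot (n + 1) k.1) (.inr c)) := by
      intro i j k
      unfold piAt
      split_ifs with h
      · simp [h]
      · rw [Formula.realize_not, realize_eqTuple (by simp [tup]), hmap, hmap, List.map_inj_left]
        simp [h]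
    have h4 : ∀ (i : Fin φ.numAtoms) (j k l : φ.Idx (n + 1)),
        (eqTuple (L := L) (φ.tup (φ.u i) j ++ φ.tup (φ.v i) k ++ φ.tup (φ.w i) j)
          (φ.tup (φ.u i) l ++ φ.tup (φ.v i) l ++ φ.tup (φ.w i) l)).Realize
        (Sum.elim v fun z => f (φ.code (n + 1) z)) ↔
        (∀ c ∈ φ.u i, f (φ.varAt (φ.slot (n + 1) j.1) (.inr c)) =
          f (φ.varAt (φ.slot (n + 1) l.1) (.inr c))) ∧
        (∀ c ∈ φ.v i, f (φ.varAt (φ.slot (n + 1) k.1) (.inr c)) =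
          f (φ.varAt (φ.slot (n + 1) l.1) (.inr c))) ∧
        ∀ c ∈ φ.w i, f (φ.varAt (φ.slot (n + 1) j.1) (.inr c)) =
          f (φ.varAt (φ.slot (n + 1) l.1) (.inr c)) := by
      intro i j k l
      rw [realize_eqTuple (by simp [tup])]
      simp only [List.map_append, hmap]
      constructor
      · intro h
        obtain ⟨h, h3⟩ := List.append_inj h (by simp)
        obtain ⟨h1, h2⟩ := List.append_inj h (by simp)
        exact ⟨List.map_inj_left.1 h1, List.map_inj_left.1 h2, List.map_inj_left.1 h3⟩
      · rintro ⟨h1, h2, h3⟩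
        rw [List.map_inj_left.2 h1, List.map_inj_left.2 h2, List.map_inj_left.2 h3]
    rw [h1, h2, PsiHolds, and_left_comm]
    refine and_congr_right fun _ => and_congr_right fun _ => forall_congr' fun i => ?_
    simp only [h3, h4]
    have hA : φ.atomSlots (n + 1) = φ.slots (n + 1) + 1 := rfl
    have hlow : ∀ s < φ.slots (n + 1) + 1, ∃ j : {j : φ.Idx (n + 1) // j.1 ≤ φ.p n},
        φ.slot (n + 1) j.1.1 = s := by
      intro s hs
      obtain ⟨i, hi, rfl⟩ := φ.exists_slot_eq (hs.trans_le (φ.slots_lt_slots_succ (n + 1)))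
      exact ⟨⟨⟨i, Finset.mem_Icc.2 hi⟩, (φ.le_p_iff hi.1).2 hs⟩, rfl⟩
    have hex : ∀ Q : ℕ → Prop, (∃ l : {l : φ.Idx (n + 1) // (φ.p n : ℤ) < l.1},
        Q (φ.slot (n + 1) l.1.1)) ↔
        ∃ l < φ.slots (n + 1 + 1) - (φ.slots (n + 1) + 1), Q (φ.slots (n + 1) + 1 + l) := by
      intro Q
      constructor
      · rintro ⟨⟨l, hl⟩, hQ⟩
        have h5 := (φ.le_p_iff l.bounds.1).not.1 (not_le.2 hl)
        have h6 := φ.slot_lt l.bounds.1 l.bounds.2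
        refine ⟨φ.slot (n + 1) l.1 - (φ.slots (n + 1) + 1), by omega, ?_⟩
        rwa [show φ.slots (n + 1) + 1 + (φ.slot (n + 1) l.1 - (φ.slots (n + 1) + 1)) =
          φ.slot (n + 1) l.1 by omega]
      · rintro ⟨l, hl, hQ⟩
        obtain ⟨i, hi, e⟩ := φ.exists_slot_eq (n := n + 1) (s := φ.slots (n + 1) + 1 + l) (by omega)
        refine ⟨⟨⟨i, Finset.mem_Icc.2 hi⟩, not_le.1 ((φ.le_p_iff hi.1).not.2 (by omega))⟩, ?_⟩
        rwa [e]
    let Q (j k l : ℕ) : Prop :=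
      (∀ c ∈ φ.u i, f (φ.varAt j (.inr c)) = f (φ.varAt l (.inr c))) ∧
      (∀ c ∈ φ.v i, f (φ.varAt k (.inr c)) = f (φ.varAt l (.inr c))) ∧
      ∀ c ∈ φ.w i, f (φ.varAt j (.inr c)) = f (φ.varAt l (.inr c))
    constructor
    · intro h j hj k hk
      rw [hA] at hj hk
      obtain ⟨j, rfl⟩ := hlow j hj
      obtain ⟨k, rfl⟩ := hlow k hk
      exact (h j k).imp_right (hex (Q _ _)).1
    · intro h j k
      exact (h _ ((φ.le_p_iff j.1.bounds.1).1 j.2) _ ((φ.le_p_iff k.1.bounds.1).1 k.2)).imp_right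
        (hex (Q _ _)).2

end NormalForm

/-! ### Single rounds of the game, truth of the approximations, and strategies. -/

namespace NormalForm

variable {L : FirstOrder.Language.{a, b}} (φ : NormalForm L) {M : Type c}

/-- The values of all variables of level `n`, from those of the universally and those of the
existentially quantified ones. -/
def join {n : ℕ} (u : φ.UnivVar n → M) (e : φ.ExVar n → M) (z : φ.LevelVar n) : M :=
  if h : φ.IsUniversal n z then u ⟨z, h⟩ else e ⟨z, h⟩

theorem join_restrict {n : ℕ} (w : φ.LevelVar n → M) :
    φ.join (fun z => w z.1) (fun z => w z.1) = w := by
  funext z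
  unfold join
  split <;> rfl

theorem join_of_isUniversal {n : ℕ} (u : φ.UnivVar n → M) (e : φ.ExVar n → M)
    {z : φ.LevelVar n} (h : φ.IsUniversal n z) : φ.join u e z = u ⟨z, h⟩ := dif_pos h

theorem exists_extend_univ {n : ℕ} (f : ℕ → M) (u : φ.UnivVar n → M) :
    ∃ g : ℕ → M, (∀ k < φ.slots n * φ.width, g k = f k) ∧
      ∀ z : φ.UnivVar n, g (φ.code n z.1) = u z := by
  refine ⟨Function.extend (fun z : φ.UnivVar n => φ.code n z.1) u f, fun k hk => ?_, fun z => ?_⟩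
  · refine Function.extend_apply' _ _ _ ?_
    rintro ⟨z, rfl⟩
    exact not_lt.2 (φ.code_of_isUniversal z.2).1 hk
  · exact ((φ.code_injective n).comp Subtype.val_injective).extend_apply u f z

theorem play_eq_join (σ : φ.Strategy M) (f : ∀ k, φ.UnivVar k → M) (n : ℕ) :
    φ.play σ f n = φ.join (f n) (σ n fun k _ => f k) := rfl

theorem playPrev_congr (σ : φ.Strategy M) {f g : ∀ k, φ.UnivVar k → M} {n : ℕ}
    (h : ∀ k < n, f k = g k) : φ.playPrev σ f n = φ.playPrev σ g n := by
  cases n with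
  | zero => rfl
  | succ n =>
    have e : (fun k (_ : k ≤ n) => f k) = fun k _ => g k :=
      funext fun k => funext fun hk => h k (Nat.lt_succ_of_le hk)
    simp only [playPrev, play_eq_join, e, h n (Nat.lt_succ_self n)]

variable [L.Structure M]

theorem realize_quantify {n : ℕ} (χ : L.Formula (φ.PrevVar n ⊕ φ.LevelVar n))
    (v : φ.PrevVar n → M) : (φ.quantify n χ).Realize v ↔
      ∀ u : φ.UnivVar n → M, ∃ e : φ.ExVar n → M, χ.Realize (Sum.elim v (φ.join u e)) := by
  unfold quantify
  rw [Formula.realize_iAlls]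
  refine forall_congr' fun u => ?_
  rw [Formula.realize_iExs]
  refine exists_congr fun e => ?_
  rw [Formula.realize_relabel]
  refine iff_of_eq (congrArg _ ?_)
  funext z
  rcases z with z | z
  · rfl
  · by_cases h : φ.IsUniversal n z <;> simp [join, h]

/-- Translates an answer of player II into an extension of an assignment. The predicate `X` is left
open to hold one continuation of the game, or all of them at once. -/
theorem exists_join_iff {n : ℕ} {v : φ.PrevVar n → M} {u : φ.UnivVar n → M} {g : ℕ → M}
    (hv : ∀ z, g (φ.codePrev n z) = v z) (hu : ∀ z : φ.UnivVar n, g (φ.code n z.1) = u z)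
    (X : (φ.LevelVar n → M) → Prop) :
    (∃ e, (φ.Psi n).Realize (Sum.elim v (φ.join u e)) ∧ X (φ.join u e)) ↔
      ∃ h : ℕ → M, (∀ k < φ.slots n * φ.width + φ.lenX, h k = g k) ∧
        φ.PsiHolds n h ∧ X fun z => h (φ.code n z) := by
  constructor
  · rintro ⟨e, h1, h2⟩
    let h := Function.extend (φ.code n) (φ.join u e) g
    have hh : ∀ z, h (φ.code n z) = φ.join u e z := fun z =>
      (φ.code_injective n).extend_apply _ _ _
    have hh' : (fun z => h (φ.code n z)) = φ.join u e := funext hh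
    rw [← hh', realize_psi] at h1
    refine ⟨h, fun k hk => ?_, h1.2, by rwa [hh']⟩
    by_cases hk' : k < φ.slots n * φ.width
    · obtain ⟨z, rfl⟩ := φ.exists_codePrev_eq hk'
      -- Player II chooses new copies of the old tuples; only the equalities in `Psi` make them
      -- agree with the previous level.
      rw [h1.1, hv]
    · obtain ⟨z, hz, rfl⟩ := φ.exists_isUniversal_code_eq (not_lt.1 hk') hk
      rw [hh, φ.join_of_isUniversal u e hz, hu ⟨z, hz⟩]
  · rintro ⟨h, h1, h2, h3⟩
    have hjoin : φ.join u (fun z => h (φ.code n z.1)) = fun z => h (φ.code n z) := by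
      rw [← φ.join_restrict fun z => h (φ.code n z)]
      congr 1
      funext z
      rw [h1 _ (φ.code_of_isUniversal z.2).2, hu]
    refine ⟨fun z => h (φ.code n z.1), ?_, by rwa [hjoin]⟩
    rw [hjoin, realize_psi]
    refine ⟨fun z => ?_, h2⟩
    rw [h1 _ ((φ.codePrev_lt z).trans_le (Nat.le_add_right _ _)), hv]

theorem forall_exists_join_iff {n : ℕ} {v : φ.PrevVar n → M} {f : ℕ → M}
    (hv : ∀ z, f (φ.codePrev n z) = v z) (X : (φ.LevelVar n → M) → Prop) :
    (∀ u, ∃ e, (φ.Psi n).Realize (Sum.elim v (φ.join u e)) ∧ X (φ.join u e)) ↔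
      ∀ g : ℕ → M, (∀ k < φ.slots n * φ.width, g k = f k) →
        ∃ h : ℕ → M, (∀ k < φ.slots n * φ.width + φ.lenX, h k = g k) ∧
          φ.PsiHolds n h ∧ X fun z => h (φ.code n z) := by
  constructor
  · intro H g hg
    exact (φ.exists_join_iff (fun z => by rw [hg _ (φ.codePrev_lt z), hv]) (fun _ => rfl) X).1
      (H fun z => g (φ.code n z.1))
  · intro H u
    obtain ⟨g, hg, hu⟩ := φ.exists_extend_univ f u
    exact (φ.exists_join_iff (fun z => by rw [hg _ (φ.codePrev_lt z), hv]) hu X).2 (H g hg)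

theorem realize_approxFrom_zero {n : ℕ} (v : φ.PrevVar n → M) :
    (φ.approxFrom 0 n).Realize v ↔
      ∀ u, ∃ e, (φ.Psi n).Realize (Sum.elim v (φ.join u e)) :=
  φ.realize_quantify _ v

theorem realize_approxFrom_succ {d n : ℕ} (v : φ.PrevVar n → M) :
    (φ.approxFrom (d + 1) n).Realize v ↔
      ∀ u, ∃ e, (φ.Psi n).Realize (Sum.elim v (φ.join u e)) ∧
        (φ.approxFrom d (n + 1)).Realize (φ.join u e) := by
  rw [approxFrom, realize_quantify]
  refine forall_congr' fun u => exists_congr fun e => ?_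
  rw [Formula.realize_inf, Formula.realize_relabel, Sum.elim_comp_inr]

/-- The shift by one arises because `approxFrom d n` has `d + 1` levels, whereas `ApproxHolds d n`
has `d`. -/
theorem realize_approxFrom_iff_approxHolds (d : ℕ) : ∀ {n : ℕ} {v : φ.PrevVar n → M} {f : ℕ → M},
    (∀ z, f (φ.codePrev n z) = v z) →
      ((φ.approxFrom d n).Realize v ↔ φ.ApproxHolds (d + 1) n f) := by
  induction d with
  | zero =>
    intro n v f hv
    have := φ.forall_exists_join_iff hv fun _ => True
    simp only [and_true] at this
    simp only [realize_approxFrom_zero, this, ApproxHolds, and_true]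
  | succ d ih =>
    intro n v f hv
    rw [realize_approxFrom_succ, φ.forall_exists_join_iff hv, ApproxHolds]
    refine forall₂_congr fun g _ => exists_congr fun h => and_congr_right fun _ =>
      and_congr_right fun _ => ?_
    exact ih fun z => rfl

theorem realize_approxFrom_of_succ {d n : ℕ} {v : φ.PrevVar n → M}
    (h : (φ.approxFrom (d + 1) n).Realize v) : (φ.approxFrom d n).Realize v := by
  induction d generalizing n with
  | zero =>
    rw [realize_approxFrom_succ] at h
    rw [realize_approxFrom_zero]
    exact fun u => (h u).imp fun e he => he.1
  | succ d ih =>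
    rw [realize_approxFrom_succ] at h ⊢
    exact fun u => (h u).imp fun e he => ⟨he.1, ih he.2⟩

/-! ### From the game to its approximations -/

theorem realize_approxFrom_playPrev {σ : φ.Strategy M}
    (hσ : ∀ f n, (φ.Psi n).Realize (Sum.elim (φ.playPrev σ f n) (φ.play σ f n))) (d : ℕ) :
    ∀ (n : ℕ) (f : ∀ k, φ.UnivVar k → M), (φ.approxFrom d n).Realize (φ.playPrev σ f n) := by
  -- Replacing the move of player I in round `n` by `u` leaves the earlier levels unchanged, since a
  -- strategy sees no future moves.
  have key : ∀ (n : ℕ) (f : ∀ k, φ.UnivVar k → M) (u : φ.UnivVar n → M), ∃ g,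
      φ.playPrev σ f n = φ.playPrev σ g n ∧
        φ.join u (σ n fun k _ => g k) = φ.play σ g n := by
    intro n f u
    refine ⟨Function.update f n u, φ.playPrev_congr σ fun k hk => ?_, ?_⟩
    · rw [Function.update_of_ne hk.ne]
    · rw [play_eq_join, Function.update_self]
  induction d with
  | zero =>
    intro n f
    rw [realize_approxFrom_zero]
    intro u
    obtain ⟨g, h1, h2⟩ := key n f u
    exact ⟨_, by rw [h1, h2]; exact hσ g n⟩
  | succ d ih =>
    intro n f
    rw [realize_approxFrom_succ]
    intro u
    obtain ⟨g, h1, h2⟩ := key n f u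
    exact ⟨_, by rw [h1, h2]; exact hσ g n, by rw [h2]; exact ih (n + 1) g⟩

theorem GameHolds.realize_approx (h : φ.GameHolds M) (n : ℕ) :
    FirstOrder.Language.Sentence.Realize M (φ.approx n) := by
  obtain ⟨σ, hσ⟩ := h
  -- A full sequence of moves of player I need not exist when `M` is empty. The outermost universal
  -- quantifier supplies a first move `u`, and repeating it gives moves for all rounds.
  have key : (φ.UnivVar 0 → M) → (φ.approxFrom n 0).Realize (default : Empty → M) := fun u => by
    have := φ.realize_approxFrom_playPrev hσ n 0
      fun k z => u ⟨(⟨0, by simp⟩, z.1.2), by simp, z.2.2⟩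
    rwa [Subsingleton.elim (φ.playPrev σ _ 0) default] at this
  change (φ.approxFrom n 0).Realize (default : Empty → M)
  cases n with
  | zero =>
    refine (φ.realize_approxFrom_zero (n := 0) _).2 fun u => ?_
    exact (φ.realize_approxFrom_zero (n := 0) _).1 (key u) u
  | succ n =>
    refine (φ.realize_approxFrom_succ (n := 0) _).2 fun u => ?_
    exact (φ.realize_approxFrom_succ (n := 0) _).1 (key u) u

/-! ### From the approximations to the game -/

/-- Answers are chosen for all positions satisfying the invariant. The strategy replays the moves of
player I, carrying the position together with its proof of the invariant. -/
theorem gameHolds_of_forall_exists (Inv : ∀ n, (φ.PrevVar n → M) → Prop)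
    (h0 : Inv 0 Empty.elim)
    (hstep : ∀ n v, Inv n v → ∀ u : φ.UnivVar n → M, ∃ e,
      (φ.Psi n).Realize (Sum.elim v (φ.join u e)) ∧ Inv (n + 1) (φ.join u e)) :
    φ.GameHolds M := by
  choose e he hInv using hstep
  let state : ∀ n, (∀ k < n, φ.UnivVar k → M) → {v : φ.PrevVar n → M // Inv n v} := fun n =>
    Nat.rec (motive := fun n => (∀ k < n, φ.UnivVar k → M) → {v : φ.PrevVar n → M // Inv n v})
      (fun _ => ⟨Empty.elim, h0⟩)
      (fun n s f =>
        let t := s fun k hk => f k (hk.trans (Nat.lt_succ_self n))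
        ⟨_, hInv n t.1 t.2 (f n (Nat.lt_succ_self n))⟩) n
  let σ : φ.Strategy M := fun n f =>
    let t := state n fun k hk => f k hk.le
    e n t.1 t.2 (f n le_rfl)
  refine ⟨σ, fun f n => ?_⟩
  have hprev : φ.playPrev σ f n = (state n fun k _ => f k).1 := by
    cases n <;> rfl
  rw [hprev]
  exact he n _ (state n fun k _ => f k).2 (f n)

/-- If every `i` failed at some stage, an `i` that is good at a common upper bound of these stages
would contradict monotonicity. -/
theorem exists_forall_of_finite {ι : Type*} [Finite ι] {Q : ℕ → ι → Prop}
    (hanti : ∀ d i, Q (d + 1) i → Q d i) (h : ∀ d, ∃ i, Q d i) : ∃ i, ∀ d, Q d i := by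
  by_contra! H
  choose d hd using H
  obtain ⟨D, hD⟩ := (Set.finite_range d).bddAbove
  obtain ⟨i, hi⟩ := h D
  exact hd i (Nat.decreasingInduction (motive := fun k _ => Q k i) (fun k _ => hanti k i) hi
    (hD ⟨i, rfl⟩))

theorem exists_forall_realize_approxFrom
    (hM : (∃ (_ : Encodable (Σ k, L.Functions k)) (_ : Encodable (Σ k, L.Relations k)),
      IsRecursivelySaturated L M) ∨ Finite M) {n : ℕ} {v : φ.PrevVar n → M}
    (hv : ∀ d, (φ.approxFrom d n).Realize v) (u : φ.UnivVar n → M) :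
    ∃ e, (φ.Psi n).Realize (Sum.elim v (φ.join u e)) ∧
      ∀ d, (φ.approxFrom d (n + 1)).Realize (φ.join u e) := by
  -- One level is used up by the present round, hence `d + 1`.
  have hv' := fun d => (φ.realize_approxFrom_succ v).1 (hv (d + 1)) u
  by_cases hfin : Finite M
  · obtain ⟨e, he⟩ := exists_forall_of_finite
      (fun d e he => ⟨he.1, φ.realize_approxFrom_of_succ he.2⟩) hv'
    exact ⟨e, (he 0).1, fun d => (he d).2⟩
  -- An infinite `M` is nonempty, which provides a default value for the variables that are not yet
  -- in play.
  · have : Infinite M := not_finite_iff_infinite.1 hfin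
    obtain ⟨g, hg, hu⟩ := φ.exists_extend_univ
      (Function.extend (φ.codePrev n) v fun _ => Classical.arbitrary M) u
    have hgv : ∀ z, g (φ.codePrev n z) = v z := fun z => by
      rw [hg _ (φ.codePrev_lt z), (φ.codePrev_injective n).extend_apply]
    have happrox : ∀ (d : ℕ) (h : ℕ → M), (φ.approxFrom d (n + 1)).Realize
        (fun z => h (φ.code n z)) ↔ φ.ApproxHolds (d + 1) (n + 1) h :=
      fun d h => φ.realize_approxFrom_iff_approxHolds d fun z => rfl
    rw [φ.exists_join_iff hgv hu fun w => ∀ d, (φ.approxFrom d (n + 1)).Realize w]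
    obtain ⟨h, h1, h2, h3⟩ := φ.exists_psiHolds_and_forall_approxHolds
      (hM.resolve_right hfin) n g fun d => by
        obtain ⟨h, h1, h2, h3⟩ := (φ.exists_join_iff hgv hu fun w =>
          (φ.approxFrom d (n + 1)).Realize w).1 (hv' d)
        exact ⟨h, h1, h2, φ.approxHolds_of_succ _ _ _ ((happrox d h).1 h3)⟩
    exact ⟨h, h1, h2, fun d => (happrox d h).2 (h3 (d + 1))⟩

end NormalForm

end IndependenceLogic

theorem mainTheorem6 (L : FirstOrder.Language.{a, b}) (M : Type c) [L.Structure M]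
    (hM : (∃ (_ : Encodable (Σ k, L.Functions k)) (_ : Encodable (Σ k, L.Relations k)),
        IndependenceLogic.IsRecursivelySaturated L M) ∨ Finite M)
    (φ : IndependenceLogic.NormalForm L) :
    φ.GameHolds M ↔ ∀ n : ℕ, FirstOrder.Language.Sentence.Realize M (φ.approx n) := by
  refine ⟨fun h n => h.realize_approx φ n, fun h => ?_⟩
  refine φ.gameHolds_of_forall_exists (fun n v => ∀ d, (φ.approxFrom d n).Realize v)
    (fun d => ?_) fun n v hv u => φ.exists_forall_realize_approxFrom hM hv u
  have := h d
  rwa [FirstOrder.Language.Sentence.Realize, Subsingleton.elim (default : Empty → M)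
    Empty.elim] at this
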